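/- Let $K$ be a finite simplicial 3-complex made of tetrahedra and their faces, in which every 2-face lies in exactly two tetrahedra, and let a consistent orientation of all its tetrahedra be fixed (for instance, a triangulated closed oriented PL 3-manifold). A *permitted configuration* is a placement $x$ of the vertices of $K$ in oriented Euclidean space $\mathbb{R}^3$ such that every tetrahedron becomes a nondegenerate Euclidean tetrahedron (different tetrahedra may intersect). It gives each edge $a$ a length $l_a$ and each tetrahedron a volume $V>0$. For edge lengths near those given by $x$, the defect angle $\omega_a$ around $a$ is the sum of the dihedral angles at $a$ of the tetrahedra containing $a$, taken with the sign $-$ for the tetrahedra whose orientation is preserved by $x$ and $+$ for those whose orientation is reversed. Let $A=(\partial\omega_a/\partial l_b)$, where $a,b$ run over all edges and the derivatives are taken at the lengths given by $x$ with all lengths other than $l_b$ fixed. Let $\mathcal C$ be a set of edges such that, for generic permitted configurations, the principal submatrix $A|_{\mathcal C}$ is nondegenerate and $|\mathcal C|=\operatorname{rank}A$. Put $f=\det(A|_{\mathcal C})$. Let $K'$ be obtained from $K$ by a $2\to3$ Pachner move, which replaces two tetrahedra $ABCD$, $ABCE$ with the common face $ABC$ by the three tetrahedra $ABDE$, $BCDE$,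 $CADE$ around a new edge $DE$ (not an edge of $K$), the other tetrahedra keeping their orientation. Let $\mathcal C'=\mathcal C\cup\{DE\}$. Then $\mathcal C'$ has the same property for $K'$ as $\mathcal C$ has for $K$ (its principal submatrix is, for generic permitted configurations, nondegenerate and of size equal to the rank of the whole matrix), and at every configuration $x$ that is permitted both for $K$ and for $K'$ the expression $$\frac{f}{\prod_{\text{edges}} l^2}\ \prod_{\text{tetrahedra}} 6V$$ computed for $(K',\mathcal C')$ equals, up to sign, the one computed for $(K,\mathcal C)$. -/

import Mathlib

open scoped RealInnerProductSpace

noncomputable section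

/-- A finite simplicial 3-complex (tetrahedra and their faces) in which every 2-face lies in exactly
two tetrahedra, together with a consistent orientation of all its tetrahedra.
`orient p q r s` is `0` unless `p, q, r, s` are the vertices of a tetrahedron of the complex, and it
is `1` or `-1` according to whether the ordering `(p, q, r, s)` is positive or negative. In
particular any triangulated closed oriented 3-manifold is such a complex. -/
structure OrientedComplex (V : Type*) where
  /-- The sign of an ordered quadruple of vertices. -/
  orient : V → V → V → V → SignType
  swap₁₂ : ∀ p q r s, orient q p r s = -orient p q r s
  swap₂₃ : ∀ p q r s, orient p r q s = -orient p q r s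
  swap₃₄ : ∀ p q r s, orient p q s r = -orient p q r s
  /-- Every 2-face `pqr` belongs to exactly two tetrahedra, and these two induce opposite
  orientations on it. -/
  closed : ∀ p q r s, orient p q r s ≠ 0 → ∃ s', s' ≠ s ∧
    (∀ t, orient p q r t ≠ 0 ↔ t = s ∨ t = s') ∧ orient p q r s' = -orient p q r s

/-- Euclidean 3-space. -/
abbrev E3 : Type := EuclideanSpace ℝ (Fin 3)

/-- The determinant with rows `(1, y₀), (1, y₁), (1, y₂), (1, y₃)`, i.e. six times the signed volume
of the tetrahedron `y₀y₁y₂y₃`. -/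
def affineDet (y : Fin 4 → E3) : ℝ :=
  Matrix.det (Matrix.of fun i : Fin 4 => ![1, y i 0, y i 1, y i 2])

/-- The volume of the tetrahedron with vertices `x v`, `v ∈ t`, where `t` has four elements
(it does not depend on the auxiliary enumeration of `t`). -/
def tetVolume {V : Type*} (x : V → E3) (t : Finset V) : ℝ :=
  if h : t.card = 4 then |affineDet fun i => x ((t.equivFinOfCardEq h).symm i)| / 6 else 0

/-- The lengths of all segments for vertices placed at the points `x v`. -/
def edgeLength {V : Type*} (x : V → E3) : Sym2 V → ℝ :=
  Sym2.lift ⟨fun p q => dist (x p) (x q), fun _ _ => dist_comm _ _⟩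

/-- The dihedral angle at the edge `pq` of a Euclidean tetrahedron `pqrs`, as a function of the edge
lengths `l`. With `u, v, w` the vectors from `p` to `q, r, s`, whose inner products are given by the
law of cosines, it is the angle between the components of `v` and `w` orthogonal to `u`. -/
def dihedral {V : Type*} (l : Sym2 V → ℝ) (p q r s : V) : ℝ :=
  let uu := l s(p, q) ^ 2
  let vv := l s(p, r) ^ 2
  let ww := l s(p, s) ^ 2
  let uv := (uu + vv - l s(q, r) ^ 2) / 2
  let uw := (uu + ww - l s(q, s) ^ 2) / 2
  let vw := (vv + ww - l s(r, s) ^ 2) / 2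
  Real.arccos ((uu * vw - uv * uw) / √((uu * vv - uv ^ 2) * (uu * ww - uw ^ 2)))

lemma dihedral_swap₁₂ {V : Type*} (l : Sym2 V → ℝ) (p q r s : V) :
    dihedral l p q r s = dihedral l q p r s := by
  simp only [dihedral]
  rw [Sym2.eq_swap (a := q) (b := p)]
  congr 2
  · ring
  · congr 1; ring

lemma dihedral_swap₃₄ {V : Type*} (l : Sym2 V → ℝ) (p q r s : V) :
    dihedral l p q r s = dihedral l p q s r := by
  simp only [dihedral]
  rw [Sym2.eq_swap (a := s) (b := r)]
  congr 2
  · ring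
  · congr 1; ring

/-- On the lengths of an actual tetrahedron, `dihedral` is the geometric dihedral angle. -/
lemma dihedral_edgeLength {V : Type*} (x : V → E3) (p q r s : V) (h : x p ≠ x q) :
    dihedral (edgeLength x) p q r s =
      InnerProductGeometry.angle
        ((x r - x p) - (⟪x q - x p, x r - x p⟫ / ⟪x q - x p, x q - x p⟫) • (x q - x p))
        ((x s - x p) - (⟪x q - x p, x s - x p⟫ / ⟪x q - x p, x q - x p⟫) • (x q - x p)) := by
  have key : ∀ a b : V, edgeLength x s(a, b) ^ 2 = ⟪x b - x a, x b - x a⟫ := by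
    intro a b
    simp only [edgeLength, Sym2.lift_mk]
    rw [dist_comm, dist_eq_norm, real_inner_self_eq_norm_sq]
  have h1 : x r - x q = (x r - x p) - (x q - x p) := by abel
  have h2 : x s - x q = (x s - x p) - (x q - x p) := by abel
  have h3 : x s - x r = (x s - x p) - (x r - x p) := by abel
  have hu : x q - x p ≠ 0 := sub_ne_zero.mpr h.symm
  simp only [dihedral, key, InnerProductGeometry.angle]
  rw [h1, h2, h3]
  generalize x q - x p = u at *
  generalize x r - x p = v at *
  generalize x s - x p = w at *
  have hpos : 0 < ⟪u, u⟫ := real_inner_self_pos.mpr hu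
  have norm_form : ∀ z : E3, ‖z - (⟪u, z⟫ / ⟪u, u⟫) • u‖ =
      √((⟪u, u⟫ * ⟪z, z⟫ - ⟪u, z⟫ ^ 2) / ⟪u, u⟫) := by
    intro z
    rw [← Real.sqrt_sq (norm_nonneg (z - (⟪u, z⟫ / ⟪u, u⟫) • u)), ← real_inner_self_eq_norm_sq]
    congr 1
    simp only [inner_sub_left, inner_sub_right, inner_smul_left, inner_smul_right,
      real_inner_comm u z, RCLike.conj_to_real]
    field_simp
    ring
  have nonneg : ∀ z : E3, 0 ≤ ⟪u, u⟫ * ⟪z, z⟫ - ⟪u, z⟫ ^ 2 := by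
    intro z
    have := real_inner_mul_inner_self_le u z
    nlinarith
  have e1 : (⟪u, u⟫ + ⟪v, v⟫ - ⟪v - u, v - u⟫) / 2 = ⟪u, v⟫ := by
    simp only [inner_sub_left, inner_sub_right, real_inner_comm u v]; ring
  have e2 : (⟪u, u⟫ + ⟪w, w⟫ - ⟪w - u, w - u⟫) / 2 = ⟪u, w⟫ := by
    simp only [inner_sub_left, inner_sub_right, real_inner_comm u w]; ring
  have e3 : (⟪v, v⟫ + ⟪w, w⟫ - ⟪w - v, w - v⟫) / 2 = ⟪v, w⟫ := by
    simp only [inner_sub_left, inner_sub_right, real_inner_comm v w]; ring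
  rw [e1, e2, e3, norm_form, norm_form, Real.sqrt_mul (nonneg v), Real.sqrt_div (nonneg v),
    Real.sqrt_div (nonneg w)]
  congr 1
  have hs : √⟪u, u⟫ * √⟪u, u⟫ = ⟪u, u⟫ := Real.mul_self_sqrt hpos.le
  rw [div_mul_div_comm, hs, div_div_eq_mul_div]
  congr 1
  simp only [inner_sub_left, inner_sub_right, inner_smul_left, inner_smul_right,
    real_inner_comm u v, RCLike.conj_to_real]
  field_simp
  ring

lemma affineDet_swap {V : Type*} (x : V → E3) (p q r s : V) :
    affineDet ![x q, x p, x r, x s] = -affineDet ![x p, x q, x r, x s] ∧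
      affineDet ![x p, x q, x s, x r] = -affineDet ![x p, x q, x r, x s] := by
  constructor <;>
  · simp [affineDet, Matrix.det_succ_row_zero, Fin.sum_univ_succ, Fin.succAbove]
    ring

namespace OrientedComplex

variable {V : Type*} (K : OrientedComplex V)

/-- The dihedral angle at the edge `a` (with respect to the lengths `l`) in the tetrahedron whose
opposite edges are `a` and `b`, with the sign `+` if the placement `x` of the vertices in Euclidean
space preserves the orientation of this tetrahedron, and `-` if it reverses it; it is `0` if `a` and
`b` are not opposite edges of a tetrahedron of the complex. -/
def signedDihedral (x : V → E3) (l : Sym2 V → ℝ) : Sym2 V → Sym2 V → ℝ :=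
  Sym2.lift₂ ⟨fun p q r s =>
    ((K.orient p q r s * SignType.sign (affineDet ![x p, x q, x r, x s]) : SignType) : ℝ) *
      dihedral l p q r s, fun p q r s => by
    constructor <;> beta_reduce
    · rw [K.swap₁₂ p q r s, (affineDet_swap x p q r s).1, Left.sign_neg, neg_mul_neg,
        dihedral_swap₁₂]
    · rw [K.swap₃₄ p q r s, (affineDet_swap x p q r s).2, Left.sign_neg, neg_mul_neg,
        dihedral_swap₃₄]⟩

variable [Fintype V] [DecidableEq V]

open scoped Classical in
/-- The set of tetrahedra of the complex. -/
def tets : Finset (Finset V) :=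
  Finset.univ.filter fun t => ∃ p q r s, K.orient p q r s ≠ 0 ∧ t = {p, q, r, s}

open scoped Classical in
/-- The set of edges of the complex. -/
def edges : Finset (Sym2 V) :=
  Finset.univ.filter fun e => ∃ p q r s, K.orient p q r s ≠ 0 ∧ e = s(p, q)

/-- The defect angle around the edge `a` for the lengths `l` (near the lengths given by `x`): the
algebraic sum of the dihedral angles at `a`, with the sign `-` for the tetrahedra whose orientation
is preserved by `x` and `+` for the others. -/
def defect (x : V → E3) (l : Sym2 V → ℝ) (a : Sym2 V) : ℝ :=
  -∑ b : Sym2 V, K.signedDihedral x l a b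

/-- The partial derivative `∂ω_a / ∂l_b`, all the other lengths being fixed, at the lengths given
by `x`. -/
def curvDeriv (x : V → E3) (a b : Sym2 V) : ℝ :=
  deriv (fun y : ℝ => K.defect x (Function.update (edgeLength x) b y) a) (edgeLength x b)

/-- The matrix `A = (∂ω_a / ∂l_b)`, with `a` and `b` running through all the edges. -/
def curvMatrix (x : V → E3) : Matrix K.edges K.edges ℝ :=
  Matrix.of fun a b => K.curvDeriv x a b

/-- `f = det (A|_C)`, the principal minor of the matrix `A` on a set `C` of edges. -/
def minor (x : V → E3) (C : Finset (Sym2 V)) : ℝ :=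
  Matrix.det (Matrix.of fun a b : C => K.curvDeriv x a b)

/-- A placement of the vertices in Euclidean space such that every tetrahedron is embedded, i.e. has
affinely independent vertices (different tetrahedra may intersect). -/
def Permitted (x : V → E3) : Prop :=
  ∀ p q r s, K.orient p q r s ≠ 0 → AffineIndependent ℝ ![x p, x q, x r, x s]

/-- A property holds for a generic permitted placement of the vertices: it holds for all permitted
placements outside the zero set of some nonzero polynomial in the coordinates of the vertices. -/
def Generically (Q : (V → E3) → Prop) : Prop :=
  ∃ P : MvPolynomial (V × Fin 3) ℝ, P ≠ 0 ∧
    ∀ x, K.Permitted x → MvPolynomial.eval (fun i : V × Fin 3 => x i.1 i.2) P ≠ 0 → Q x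

/-- `C` is a set of edges such that, in general position, the principal submatrix `A|_C` is
nondegenerate and its size equals the rank of `A`. -/
def IsMaximalSet (C : Finset (Sym2 V)) : Prop :=
  C ⊆ K.edges ∧ K.Generically fun x => K.minor x C ≠ 0 ∧ (K.curvMatrix x).rank = C.card

/-- The expression `f · ∏ 6V / ∏ l²`, with products over all tetrahedra and over all edges. -/
def invariantExpr (x : V → E3) (C : Finset (Sym2 V)) : ℝ :=
  K.minor x C * (∏ t ∈ K.tets, 6 * tetVolume x t) / ∏ e ∈ K.edges, edgeLength x e ^ 2

/-- `K'` is obtained from `K` by the `2 → 3` Pachner move that replaces the two tetrahedra `ABCD`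
and `ABCE` by the three tetrahedra `ABDE`, `BCDE` and `CADE` with the new common edge `DE`. The
remaining tetrahedra keep their orientation. -/
structure IsPachnerMove23 (K K' : OrientedComplex V) (A B C D E : V) : Prop where
  left : K.orient A B C D ≠ 0
  right : K.orient A B C E ≠ 0
  ne : D ≠ E
  newEdge : s(D, E) ∉ K.edges
  tets_eq : K'.tets = (K.tets \ {{A, B, C, D}, {A, B, C, E}}) ∪
    {{A, B, D, E}, {B, C, D, E}, {C, A, D, E}}
  orient_eq : ∀ p q r s, ({p, q, r, s} : Finset V) ∈ K.tets → {p, q, r, s} ∈ K'.tets →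
    K'.orient p q r s = K.orient p q r s

end OrientedComplex

end

noncomputable section

/-! The two complexes differ, as oriented chains of tetrahedra, by the boundary of the 4-simplex
`ABCDE`. Its five vertices lie in 3-space, so they carry an affine dependence, whose coefficients
`μ` are up to sign the quantities `6V` of the opposite faces.

Around an edge `pq` of this simplex the change of the defect angle involves only the three faces
containing `pq`. Their signed angles add up to a constant as long as the lengths stay realisable in
3-space, so the derivative of the sum must be a multiple of the linearised realisability condition
`∑ μ i * μ j * d(l_ij²) = 0`. Finding the multiple (`sum_angleRate`, `sum_angleRate_div_affineDet`)
and using the symmetry between the vertices gives `curvDeriv_eq_add`: the new matrix is the old one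
minus `M⁻¹ w wᵀ`, where `w_pq = l_pq * μ p * μ q` and `M` is the product of the five `μ`.

Since `DE` is not an edge of `K`, its row and column in the old matrix are zero. Elimination with
the new row multiplies the minor by `-w_DE² / M` (`det_insert_of_sub_mul`), and the rank grows by at
most one because the perturbation has rank one. Finally `w_DE² / M = l_DE² * μ D * μ E / (μ A * μ B
* μ C)`, which is up to sign `l_DE²` times the two old values of `6V` over the three new ones:
exactly what the products of lengths and volumes compensate. -/

/-! ### Derivative of a dihedral angle with respect to the lengths. -/

lemma hasDerivAt_arccos_div_sqrt {N P : ℝ → ℝ} {N' P' y : ℝ} (hN : HasDerivAt N N' y)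
    (hP : HasDerivAt P P' y) (h : N y ^ 2 < P y) :
    HasDerivAt (fun z => Real.arccos (N z / √(P z)))
      (-(N' - N y * P' / (2 * P y)) / √(P y - N y ^ 2)) y := by
  have hpos : 0 < P y := lt_of_le_of_lt (sq_nonneg _) h
  have hs : 0 < √(P y) := Real.sqrt_pos.mpr hpos
  have hss : √(P y) ^ 2 = P y := Real.sq_sqrt hpos.le
  have hlt : (N y / √(P y)) ^ 2 < 1 := by
    rw [div_pow, hss, div_lt_one hpos]
    exact h
  have h1 : N y / √(P y) ≠ -1 := by
    intro e
    rw [e] at hlt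
    norm_num at hlt
  have h2 : N y / √(P y) ≠ 1 := by
    intro e
    rw [e] at hlt
    norm_num at hlt
  have hd := (Real.hasDerivAt_arccos h1 h2).comp y (hN.div (hP.sqrt hpos.ne') hs.ne')
  have ht : 0 < √(P y - N y ^ 2) := Real.sqrt_pos.mpr (sub_pos.mpr h)
  have e : √(1 - (N y / √(P y)) ^ 2) = √(P y - N y ^ 2) / √(P y) := by
    rw [← Real.sqrt_div (sub_pos.mpr h).le, div_pow, hss]
    congr 1
    field_simp
  refine hd.congr_deriv ?_
  rw [e, hss]
  generalize √(P y - N y ^ 2) = T at *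
  generalize √(P y) = S at *
  rw [← hss]
  field_simp

/-- For a tetrahedron with squared edge lengths `X` varying with velocities `g`, the negative of the
velocity of the dihedral angle at the edge `pq` multiplied by the length of this edge and by six
times the volume. -/
def angleRate {V : Type*} (X g : Sym2 V → ℝ) (p q r s : V) : ℝ :=
  let uu := X s(p, q)
  let vv := X s(p, r)
  let ww := X s(p, s)
  let uv := (uu + vv - X s(q, r)) / 2
  let uw := (uu + ww - X s(q, s)) / 2
  let vw := (vv + ww - X s(r, s)) / 2
  let uu' := g s(p, q)
  let vv' := g s(p, r)
  let ww' := g s(p, s)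
  let uv' := (uu' + vv' - g s(q, r)) / 2
  let uw' := (uu' + ww' - g s(q, s)) / 2
  let vw' := (vv' + ww' - g s(r, s)) / 2
  (uu' * vw + uu * vw' - uv' * uw - uv * uw') - (uu * vw - uv * uw) / 2 *
    ((uu' * vv + uu * vv' - 2 * uv * uv') / (uu * vv - uv ^ 2) +
      (uu' * ww + uu * ww' - 2 * uw * uw') / (uu * ww - uw ^ 2))

lemma affineDet_eq (a b c d : E3) : affineDet ![a, b, c, d] =
    (b 0 - a 0) * ((c 1 - a 1) * (d 2 - a 2) - (c 2 - a 2) * (d 1 - a 1)) -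
    (b 1 - a 1) * ((c 0 - a 0) * (d 2 - a 2) - (c 2 - a 2) * (d 0 - a 0)) +
    (b 2 - a 2) * ((c 0 - a 0) * (d 1 - a 1) - (c 1 - a 1) * (d 0 - a 0)) := by
  simp [affineDet, Matrix.det_succ_row_zero, Fin.sum_univ_succ, Fin.succAbove]
  ring

lemma edgeLength_sq {V : Type*} (x : V → E3) (p q : V) : edgeLength x s(p, q) ^ 2 =
    (x p 0 - x q 0) ^ 2 + (x p 1 - x q 1) ^ 2 + (x p 2 - x q 2) ^ 2 := by
  simp only [edgeLength, Sym2.lift_mk]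
  rw [EuclideanSpace.dist_eq, Real.sq_sqrt (by positivity)]
  simp [Fin.sum_univ_three, Real.dist_eq, sq_abs]

lemma ne_of_affineDet_ne_zero {a b c d : E3} (h : affineDet ![a, b, c, d] ≠ 0) :
    a ≠ b ∧ a ≠ c ∧ a ≠ d := by
  refine ⟨?_, ?_, ?_⟩ <;> rintro rfl <;> apply h <;> rw [affineDet_eq] <;> ring

/-- The velocity of the dihedral angle, with the sign of the orientation of the tetrahedron. -/
lemma hasDerivAt_sign_mul_dihedral {V : Type*} (x : V → E3) (p q r s : V)
    (hx : affineDet ![x p, x q, x r, x s] ≠ 0) (l : ℝ → Sym2 V → ℝ) (l' : Sym2 V → ℝ) (y : ℝ)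
    (hl : ∀ e, HasDerivAt (fun z => l z e) (l' e) y) (hy : l y = edgeLength x) :
    HasDerivAt (fun z => (SignType.sign (affineDet ![x p, x q, x r, x s]) : ℝ) *
        dihedral (l z) p q r s)
      (-angleRate (fun e => edgeLength x e ^ 2) (fun e => 2 * edgeLength x e * l' e) p q r s /
        (edgeLength x s(p, q) * affineDet ![x p, x q, x r, x s])) y := by
  have hX : ∀ e, HasDerivAt (fun z => l z e ^ 2) (2 * edgeLength x e * l' e) y := by
    intro e
    have := (hl e).fun_pow 2
    rw [hy] at this
    simpa using this
  have huv := (((hX s(p, q)).add (hX s(p, r))).sub (hX s(q, r))).div_const 2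
  have huw := (((hX s(p, q)).add (hX s(p, s))).sub (hX s(q, s))).div_const 2
  have hvw := (((hX s(p, r)).add (hX s(p, s))).sub (hX s(r, s))).div_const 2
  have hN := ((hX s(p, q)).mul hvw).sub (huv.mul huw)
  have hD₁ := ((hX s(p, q)).mul (hX s(p, r))).sub (huv.pow 2)
  have hD₂ := ((hX s(p, q)).mul (hX s(p, s))).sub (huw.pow 2)
  have hP := hD₁.mul hD₂
  have hlpq : 0 < edgeLength x s(p, q) := by
    simpa [edgeLength] using (ne_of_affineDet_ne_zero hx).1
  set Δ := affineDet ![x p, x q, x r, x s] with hΔ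
  set L := edgeLength x with hL
  -- This Gram identity evaluates the root `√(P - N²)` in the derivative of the arccosine as the
  -- length of `pq` times six times the volume.
  have key : ((L s(p, q) ^ 2 * L s(p, r) ^ 2 - ((L s(p, q) ^ 2 + L s(p, r) ^ 2 - L s(q, r) ^ 2) / 2) ^ 2) *
      (L s(p, q) ^ 2 * L s(p, s) ^ 2 - ((L s(p, q) ^ 2 + L s(p, s) ^ 2 - L s(q, s) ^ 2) / 2) ^ 2)) -
      (L s(p, q) ^ 2 * ((L s(p, r) ^ 2 + L s(p, s) ^ 2 - L s(r, s) ^ 2) / 2) -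
        ((L s(p, q) ^ 2 + L s(p, r) ^ 2 - L s(q, r) ^ 2) / 2) *
        ((L s(p, q) ^ 2 + L s(p, s) ^ 2 - L s(q, s) ^ 2) / 2)) ^ 2 =
      (L s(p, q) * |Δ|) ^ 2 := by
    rw [mul_pow, sq_abs]
    simp only [hL, hΔ, edgeLength_sq, affineDet_eq]
    -- Moving `p` to the origin keeps the polynomial identity small enough for `ring`.
    obtain ⟨u0, e0⟩ : ∃ u, u = x q 0 - x p 0 := ⟨_, rfl⟩
    obtain ⟨u1, e1⟩ : ∃ u, u = x q 1 - x p 1 := ⟨_, rfl⟩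
    obtain ⟨u2, e2⟩ : ∃ u, u = x q 2 - x p 2 := ⟨_, rfl⟩
    obtain ⟨v0, f0⟩ : ∃ u, u = x r 0 - x p 0 := ⟨_, rfl⟩
    obtain ⟨v1, f1⟩ : ∃ u, u = x r 1 - x p 1 := ⟨_, rfl⟩
    obtain ⟨v2, f2⟩ : ∃ u, u = x r 2 - x p 2 := ⟨_, rfl⟩
    obtain ⟨w0, g0⟩ : ∃ u, u = x s 0 - x p 0 := ⟨_, rfl⟩
    obtain ⟨w1, g1⟩ : ∃ u, u = x s 1 - x p 1 := ⟨_, rfl⟩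
    obtain ⟨w2, g2⟩ : ∃ u, u = x s 2 - x p 2 := ⟨_, rfl⟩
    rw [← e0, ← e1, ← e2, ← f0, ← f1, ← f2, ← g0, ← g1, ← g2]
    rw [← add_eq_of_eq_sub e0, ← add_eq_of_eq_sub e1, ← add_eq_of_eq_sub e2,
      ← add_eq_of_eq_sub f0, ← add_eq_of_eq_sub f1, ← add_eq_of_eq_sub f2,
      ← add_eq_of_eq_sub g0, ← add_eq_of_eq_sub g1, ← add_eq_of_eq_sub g2]
    ring
  have hpos : 0 < L s(p, q) * |Δ| := mul_pos hlpq (abs_pos.mpr hx)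
  have hlt := sub_pos.mp (key.symm ▸ pow_pos hpos 2)
  have h := (hasDerivAt_arccos_div_sqrt hN hP (by simpa [hy] using hlt)).const_mul
    (SignType.sign Δ : ℝ)
  refine h.congr_deriv ?_
  have hDD := lt_of_le_of_lt (sq_nonneg _) hlt
  have hD₁ := left_ne_zero_of_mul hDD.ne'
  have hD₂ := right_ne_zero_of_mul hDD.ne'
  simp only [Pi.mul_apply, Pi.sub_apply, Pi.add_apply, Pi.pow_apply, hy]
  rw [key, Real.sqrt_sq hpos.le]
  have hsg : (SignType.sign Δ : ℝ) * |Δ| = Δ := sign_mul_abs Δ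
  have hsg2 : (SignType.sign Δ : ℝ) * Δ = |Δ| := sign_mul_self Δ
  have hab : |Δ| ≠ 0 := abs_ne_zero.mpr hx
  simp only [angleRate]
  generalize (SignType.sign Δ : ℝ) = σ at *
  generalize (L s(p, q) ^ 2 * L s(p, r) ^ 2 - ((L s(p, q) ^ 2 + L s(p, r) ^ 2 - L s(q, r) ^ 2) / 2) ^ 2) = D1 at *
  generalize (L s(p, q) ^ 2 * L s(p, s) ^ 2 - ((L s(p, q) ^ 2 + L s(p, s) ^ 2 - L s(q, s) ^ 2) / 2) ^ 2) = D2 at *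
  -- The sign of the placement turns the absolute volume into the signed one, so the derivative
  -- becomes rational in the coordinates up to edge lengths.
  have hsd : σ / |Δ| = 1 / Δ := by field_simp; linarith
  rw [show ∀ t : ℝ, σ * (t / (L s(p, q) * |Δ|)) = t / L s(p, q) * (σ / |Δ|) from
    fun t => by field_simp, hsd]
  field_simp
  ring

/-! ### Angle sums around an edge for five points in space. -/

/-- Infinitesimal form of the additivity of dihedral angles around the common edge `pq` of three
tetrahedra, in terms of an affine dependence `m` between the five vertices. -/
lemma sum_angleRate {V : Type*} (X g : Sym2 V → ℝ) (p q r s t : V) (mp mq mr ms mt : ℝ)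
    (hm : mp + mq + mr + ms + mt = 0)
    (hu : mq * X s(p, q) + mr * ((X s(p, q) + X s(p, r) - X s(q, r)) / 2) +
      ms * ((X s(p, q) + X s(p, s) - X s(q, s)) / 2) +
      mt * ((X s(p, q) + X s(p, t) - X s(q, t)) / 2) = 0)
    (hr : mq * ((X s(p, q) + X s(p, r) - X s(q, r)) / 2) + mr * X s(p, r) +
      ms * ((X s(p, r) + X s(p, s) - X s(r, s)) / 2) +
      mt * ((X s(p, t) + X s(p, r) - X s(t, r)) / 2) = 0)
    (hs : mq * ((X s(p, q) + X s(p, s) - X s(q, s)) / 2) +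
      mr * ((X s(p, r) + X s(p, s) - X s(r, s)) / 2) + ms * X s(p, s) +
      mt * ((X s(p, s) + X s(p, t) - X s(s, t)) / 2) = 0)
    (ht : mq * ((X s(p, q) + X s(p, t) - X s(q, t)) / 2) +
      mr * ((X s(p, t) + X s(p, r) - X s(t, r)) / 2) +
      ms * ((X s(p, s) + X s(p, t) - X s(s, t)) / 2) + mt * X s(p, t) = 0)
    (hDr : X s(p, q) * X s(p, r) - ((X s(p, q) + X s(p, r) - X s(q, r)) / 2) ^ 2 ≠ 0)
    (hDs : X s(p, q) * X s(p, s) - ((X s(p, q) + X s(p, s) - X s(q, s)) / 2) ^ 2 ≠ 0)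
    (hDt : X s(p, q) * X s(p, t) - ((X s(p, q) + X s(p, t) - X s(q, t)) / 2) ^ 2 ≠ 0) :
    mr * ms * angleRate X g p q r s + ms * mt * angleRate X g p q s t +
      mt * mr * angleRate X g p q t r = -(X s(p, q) / 2) *
      (mp * mq * g s(p, q) + mp * mr * g s(p, r) + mp * ms * g s(p, s) + mp * mt * g s(p, t) +
        mq * mr * g s(q, r) + mq * ms * g s(q, s) + mq * mt * g s(q, t) +
        mr * ms * g s(r, s) + ms * mt * g s(s, t) + mt * mr * g s(t, r)) := by
  obtain rfl : mp = -(mq + mr + ms + mt) := by linarith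
  simp only [angleRate]
  -- The logarithmic derivatives of the Gram minors `D` of `pq` with `pr`, `ps`, `pt` become
  -- variables `zr`, `zs`, `zt`, known only through `z * D = D'`.
  have kr := div_mul_cancel₀ (g s(p, q) * X s(p, r) + X s(p, q) * g s(p, r) -
    2 * ((X s(p, q) + X s(p, r) - X s(q, r)) / 2) * ((g s(p, q) + g s(p, r) - g s(q, r)) / 2)) hDr
  have ks := div_mul_cancel₀ (g s(p, q) * X s(p, s) + X s(p, q) * g s(p, s) -
    2 * ((X s(p, q) + X s(p, s) - X s(q, s)) / 2) * ((g s(p, q) + g s(p, s) - g s(q, s)) / 2)) hDs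
  have kt := div_mul_cancel₀ (g s(p, q) * X s(p, t) + X s(p, q) * g s(p, t) -
    2 * ((X s(p, q) + X s(p, t) - X s(q, t)) / 2) * ((g s(p, q) + g s(p, t) - g s(q, t)) / 2)) hDt
  generalize (g s(p, q) * X s(p, r) + X s(p, q) * g s(p, r) -
    2 * ((X s(p, q) + X s(p, r) - X s(q, r)) / 2) * ((g s(p, q) + g s(p, r) - g s(q, r)) / 2)) /
    (X s(p, q) * X s(p, r) - ((X s(p, q) + X s(p, r) - X s(q, r)) / 2) ^ 2) = zr at *
  generalize (g s(p, q) * X s(p, s) + X s(p, q) * g s(p, s) -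
    2 * ((X s(p, q) + X s(p, s) - X s(q, s)) / 2) * ((g s(p, q) + g s(p, s) - g s(q, s)) / 2)) /
    (X s(p, q) * X s(p, s) - ((X s(p, q) + X s(p, s) - X s(q, s)) / 2) ^ 2) = zs at *
  generalize (g s(p, q) * X s(p, t) + X s(p, q) * g s(p, t) -
    2 * ((X s(p, q) + X s(p, t) - X s(q, t)) / 2) * ((g s(p, q) + g s(p, t) - g s(q, t)) / 2)) /
    (X s(p, q) * X s(p, t) - ((X s(p, q) + X s(p, t) - X s(q, t)) / 2) ^ 2) = zt at *
  -- Projecting the dependence orthogonally to `pq` and pairing with the projection of `pr` gives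
  -- `mr * D_r + ms * N_rs + mt * N_tr = 0`, with `N` the numerators of the cosines; this is the
  -- last bracket with `hr`. It turns the `zr` terms into `mr² * D_r' / 2`, and likewise for `s` and
  -- `t`. What remains is half the variation, with `m` fixed, of a quadratic form in `m`, and the
  -- first two lines reduce it to the variation of `∑ m i * m j * X_ij`.
  linear_combination
    (g s(p, q) / 2) * (mr * hr + ms * hs + mt * ht - mq * hu) -
    (mr * ((g s(p, q) + g s(p, r) - g s(q, r)) / 2) +
      ms * ((g s(p, q) + g s(p, s) - g s(q, s)) / 2) +
      mt * ((g s(p, q) + g s(p, t) - g s(q, t)) / 2)) * hu +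
    (mr ^ 2 / 2) * kr + (ms ^ 2 / 2) * ks + (mt ^ 2 / 2) * kt -
    (zr * mr / 2) * (X s(p, q) * hr - ((X s(p, q) + X s(p, r) - X s(q, r)) / 2) * hu) -
    (zs * ms / 2) * (X s(p, q) * hs - ((X s(p, q) + X s(p, s) - X s(q, s)) / 2) * hu) -
    (zt * mt / 2) * (X s(p, q) * ht - ((X s(p, q) + X s(p, t) - X s(q, t)) / 2) * hu)

lemma eq_zero_of_sum_sq_eq_zero {a b c : ℝ} (h : a ^ 2 + b ^ 2 + c ^ 2 = 0) :
    a = 0 ∧ b = 0 ∧ c = 0 :=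
  ⟨by nlinarith [sq_nonneg a, sq_nonneg b, sq_nonneg c],
    by nlinarith [sq_nonneg a, sq_nonneg b, sq_nonneg c],
    by nlinarith [sq_nonneg a, sq_nonneg b, sq_nonneg c]⟩

/-- The Gram determinant is the squared norm of the cross product of two edge vectors, and pairing
that cross product with the third edge vector gives `affineDet`. -/
lemma det_gram_ne_zero {V : Type*} (x : V → E3) (p q r s : V)
    (h : affineDet ![x p, x q, x r, x s] ≠ 0) :
    edgeLength x s(p, q) ^ 2 * edgeLength x s(p, r) ^ 2 -
      ((edgeLength x s(p, q) ^ 2 + edgeLength x s(p, r) ^ 2 - edgeLength x s(q, r) ^ 2) / 2) ^ 2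
      ≠ 0 := by
  intro h0
  simp only [edgeLength_sq] at h0
  have h1 : ((x q 1 - x p 1) * (x r 2 - x p 2) - (x q 2 - x p 2) * (x r 1 - x p 1)) ^ 2 +
      ((x q 0 - x p 0) * (x r 2 - x p 2) - (x q 2 - x p 2) * (x r 0 - x p 0)) ^ 2 +
      ((x q 0 - x p 0) * (x r 1 - x p 1) - (x q 1 - x p 1) * (x r 0 - x p 0)) ^ 2 = 0 := by
    rw [← h0]
    ring
  obtain ⟨e0, e1, e2⟩ := eq_zero_of_sum_sq_eq_zero h1
  apply h
  rw [affineDet_eq]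
  linear_combination (x s 0 - x p 0) * e0 - (x s 1 - x p 1) * e1 + (x s 2 - x p 2) * e2

/-- Laplace expansion of a 5 × 5 determinant with a repeated column: the signed face volumes are the
coefficients of an affine dependence. -/
lemma sum_affineDet (a b c d e : E3) :
    affineDet ![b, c, d, e] - affineDet ![a, c, d, e] + affineDet ![a, b, d, e] -
      affineDet ![a, b, c, e] + affineDet ![a, b, c, d] = 0 ∧
    ∀ i, affineDet ![b, c, d, e] * a i - affineDet ![a, c, d, e] * b i +
      affineDet ![a, b, d, e] * c i - affineDet ![a, b, c, e] * d i +
      affineDet ![a, b, c, d] * e i = 0 := by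
  simp only [affineDet_eq]
  constructor
  · ring
  · intro i
    fin_cases i <;> simp <;> ring

/-- By the law of cosines each fraction is an inner product of vectors issuing from `p`; the sum
pairs the affine dependence, based at `p`, with `x v - x p`. -/
lemma sum_mul_inner_eq_zero {V : Type*} (x : V → E3) (p q r s t v : V) (mp mq mr ms mt : ℝ)
    (hm : mp + mq + mr + ms + mt = 0)
    (hx : ∀ i, mp * x p i + mq * x q i + mr * x r i + ms * x s i + mt * x t i = 0) :
    mq * ((edgeLength x s(p, q) ^ 2 + edgeLength x s(p, v) ^ 2 - edgeLength x s(q, v) ^ 2) / 2) +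
    mr * ((edgeLength x s(p, r) ^ 2 + edgeLength x s(p, v) ^ 2 - edgeLength x s(r, v) ^ 2) / 2) +
    ms * ((edgeLength x s(p, s) ^ 2 + edgeLength x s(p, v) ^ 2 - edgeLength x s(s, v) ^ 2) / 2) +
    mt * ((edgeLength x s(p, t) ^ 2 + edgeLength x s(p, v) ^ 2 - edgeLength x s(t, v) ^ 2) / 2)
      = 0 := by
  simp only [edgeLength_sq]
  obtain rfl : mp = -(mq + mr + ms + mt) := by linarith
  linear_combination (x v 0 - x p 0) * hx 0 + (x v 1 - x p 1) * hx 1 + (x v 2 - x p 2) * hx 2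

lemma edgeLength_self {V : Type*} (x : V → E3) (p : V) : edgeLength x s(p, p) = 0 := by
  simp [edgeLength]

/-- The sum of the velocities of the signed dihedral angles at the edge `pq` of the tetrahedra
`pqrs`, `pqst`, `pqtr`. -/
lemma sum_angleRate_div_affineDet {V : Type*} (x : V → E3) (g : Sym2 V → ℝ) (p q r s t : V)
    (ht : affineDet ![x p, x q, x r, x s] ≠ 0) (hs : affineDet ![x p, x q, x r, x t] ≠ 0)
    (hr : affineDet ![x p, x q, x s, x t] ≠ 0)
    (mp mq mr ms mt : ℝ)
    (ep : mp = affineDet ![x q, x r, x s, x t]) (eq : mq = -affineDet ![x p, x r, x s, x t])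
    (er : mr = affineDet ![x p, x q, x s, x t]) (es : ms = -affineDet ![x p, x q, x r, x t])
    (et : mt = affineDet ![x p, x q, x r, x s]) :
    angleRate (fun e => edgeLength x e ^ 2) g p q r s / affineDet ![x p, x q, x r, x s] +
    angleRate (fun e => edgeLength x e ^ 2) g p q s t / affineDet ![x p, x q, x s, x t] +
    angleRate (fun e => edgeLength x e ^ 2) g p q t r / affineDet ![x p, x q, x t, x r] =
    -(edgeLength x s(p, q) ^ 2 / (2 * (mr * ms * mt))) *
      (mp * mq * g s(p, q) + mp * mr * g s(p, r) + mp * ms * g s(p, s) + mp * mt * g s(p, t) +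
        mq * mr * g s(q, r) + mq * ms * g s(q, s) + mq * mt * g s(q, t) +
        mr * ms * g s(r, s) + ms * mt * g s(s, t) + mt * mr * g s(t, r)) := by
  obtain ⟨h0, hi⟩ := sum_affineDet (x p) (x q) (x r) (x s) (x t)
  have hm : mp + mq + mr + ms + mt = 0 := by rw [ep, eq, er, es, et, ← h0]; ring
  have hx : ∀ i, mp * x p i + mq * x q i + mr * x r i + ms * x s i + mt * x t i = 0 := by
    intro i
    rw [ep, eq, er, es, et, ← hi i]
    ring
  have hsw : affineDet ![x p, x q, x t, x r] = ms := by
    rw [es, (affineDet_swap x p q r t).2]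
  have key := sum_angleRate (fun e => edgeLength x e ^ 2) g p q r s t mp mq mr ms mt hm
    (by
      have h := sum_mul_inner_eq_zero x p q r s t q mp mq mr ms mt hm hx
      simp only [edgeLength_self, Sym2.eq_swap (a := r) (b := q), Sym2.eq_swap (a := s) (b := q),
        Sym2.eq_swap (a := t) (b := q)] at h
      linear_combination h)
    (by
      have h := sum_mul_inner_eq_zero x p q r s t r mp mq mr ms mt hm hx
      simp only [edgeLength_self, Sym2.eq_swap (a := s) (b := r)] at h
      linear_combination h)
    (by
      have h := sum_mul_inner_eq_zero x p q r s t s mp mq mr ms mt hm hx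
      simp only [edgeLength_self, Sym2.eq_swap (a := t) (b := s)] at h
      linear_combination h)
    (by
      have h := sum_mul_inner_eq_zero x p q r s t t mp mq mr ms mt hm hx
      simp only [edgeLength_self, Sym2.eq_swap (a := r) (b := t)] at h
      linear_combination h)
    (det_gram_ne_zero x p q r s ht) (det_gram_ne_zero x p q s t hr)
    (det_gram_ne_zero x p q t r (by rw [(affineDet_swap x p q r t).2]; exact neg_ne_zero.mpr hs))
  -- The three denominators are `mt`, `mr`, `ms`; clearing them produces exactly the weights `mr *
  -- ms`, `ms * mt`, `mt * mr` of `key`.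
  rw [hsw, ← et, ← er]
  have hr0 : mr ≠ 0 := er ▸ hr
  have hs0 : ms ≠ 0 := es ▸ neg_ne_zero.mpr hs
  have ht0 : mt ≠ 0 := et ▸ ht
  field_simp
  linear_combination 2 * key

/-- A linear dependence of the rows is an affine dependence of the points: the column of ones says
that the weights sum to zero. -/
lemma affineDet_ne_zero_iff (y : Fin 4 → E3) : affineDet y ≠ 0 ↔ AffineIndependent ℝ y := by
  rw [affineDet, Ne, ← Matrix.exists_vecMul_eq_zero_iff, affineIndependent_iff_of_fintype]
  have aux : ∀ w : Fin 4 → ℝ, (Matrix.vecMul w (Matrix.of fun i => ![1, y i 0, y i 1, y i 2]) = 0 ↔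
      ∑ i, w i = 0 ∧ ∑ i, w i • y i = 0) := by
    intro w
    constructor
    · intro h
      have h0 := congrFun h 0
      have h1 := congrFun h 1
      have h2 := congrFun h 2
      have h3 := congrFun h 3
      simp [Matrix.vecMul, dotProduct] at h0 h1 h2 h3
      refine ⟨h0, ?_⟩
      ext j
      fin_cases j <;> simp [h1, h2, h3]
    · rintro ⟨h0, h⟩
      have h1 := congrArg (fun z : E3 => z 0) h
      have h2 := congrArg (fun z : E3 => z 1) h
      have h3 := congrArg (fun z : E3 => z 2) h
      simp at h1 h2 h3
      ext j
      fin_cases j <;> simp [Matrix.vecMul, dotProduct, h0, h1, h2, h3]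
  constructor
  · intro h w hw hv
    rw [Finset.weightedVSub_eq_linear_combination _ hw] at hv
    by_contra hne
    push Not at hne
    obtain ⟨i, hi⟩ := hne
    exact h ⟨w, fun e => hi (congrFun e i), (aux w).mpr ⟨hw, hv⟩⟩
  · rintro h ⟨w, hw, hv⟩
    obtain ⟨h1, h2⟩ := (aux w).mp hv
    exact hw (funext (h w h1 (by rwa [Finset.weightedVSub_eq_linear_combination _ h1])))

/-! ### The curvature matrix as a sum over tetrahedra. -/

/-- The velocity of the dihedral angle at `pq`, with the sign of the orientation of the tetrahedron
`pqrs`, when the length `b` increases with unit velocity. -/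
def dihedralRate {V : Type*} [DecidableEq V] (x : V → E3) (b : Sym2 V) (p q r s : V) : ℝ :=
  -angleRate (fun e => edgeLength x e ^ 2)
    (fun e => 2 * edgeLength x e * if e = b then 1 else 0) p q r s /
    (edgeLength x s(p, q) * affineDet ![x p, x q, x r, x s])

namespace OrientedComplex

variable {V : Type*} [DecidableEq V] (K : OrientedComplex V)

lemma hasDerivAt_signedDihedral {x : V → E3} (hx : K.Permitted x) (b : Sym2 V) (p q r s : V) :
    HasDerivAt (fun y => K.signedDihedral x (Function.update (edgeLength x) b y) s(p, q) s(r, s))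
      (K.orient p q r s * dihedralRate x b p q r s) (edgeLength x b) := by
  by_cases h : K.orient p q r s = 0
  · simpa [signedDihedral, h] using hasDerivAt_const (edgeLength x b) (0 : ℝ)
  have hΔ := (affineDet_ne_zero_iff _).mpr (hx p q r s h)
  have hd := hasDerivAt_sign_mul_dihedral x p q r s hΔ
    (fun y => Function.update (edgeLength x) b y) (fun e => if e = b then 1 else 0)
    (edgeLength x b)
    (by
      intro e
      by_cases he : e = b
      · subst he
        simpa using hasDerivAt_id' _
      · simpa [Function.update_of_ne he, he] using hasDerivAt_const (edgeLength x b) _)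
    (Function.update_eq_self _ _)
  refine (hd.const_mul (K.orient p q r s : ℝ)).congr_of_eventuallyEq (.of_forall fun y => ?_)
  simp [signedDihedral, mul_assoc]

/-- The contribution of the opposite edges `a`, `c` of a tetrahedron to `-∂ω_a / ∂l_b`. -/
def signedRate (x : V → E3) (b a c : Sym2 V) : ℝ :=
  deriv (fun y => K.signedDihedral x (Function.update (edgeLength x) b y) a c) (edgeLength x b)

lemma signedRate_mk {x : V → E3} (hx : K.Permitted x) (b : Sym2 V) (p q r s : V) :
    K.signedRate x b s(p, q) s(r, s) = K.orient p q r s * dihedralRate x b p q r s :=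
  (K.hasDerivAt_signedDihedral hx b p q r s).deriv

lemma curvDeriv_eq_neg_sum [Fintype V] {x : V → E3} (hx : K.Permitted x) (a b : Sym2 V) :
    K.curvDeriv x a b = -∑ c, K.signedRate x b a c := by
  simp only [curvDeriv, defect, signedRate]
  rw [deriv.fun_neg, deriv_fun_sum]
  intro c _
  induction a with | _ p q =>
  induction c with | _ r s =>
  exact (K.hasDerivAt_signedDihedral hx b p q r s).differentiableAt

end OrientedComplex

/-! ### The boundary of a 4-simplex and its symmetry. -/

/-- The function `O` of ordered quadruples is `η` times the boundary of the oriented 4-simplex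
`pqrst`, and `μ v` is, up to the resulting sign, six times the volume of its face opposite to `v` for
the placement `x` of the vertices in space. -/
structure IsSimplexBoundary {V : Type*} (O : V → V → V → V → ℝ) (x : V → E3) (μ : V → ℝ)
    (M η : ℝ) (p q r s t : V) : Prop where
  sq : η ^ 2 = 1
  nodup : [p, q, r, s, t].Nodup
  swap₁₂ : ∀ a b c d, O b a c d = -O a b c d
  swap₂₃ : ∀ a b c d, O a c b d = -O a b c d
  swap₃₄ : ∀ a b c d, O a b d c = -O a b c d
  support : ∀ a b c d, O a b c d ≠ 0 → [a, b, c, d] ⊆ [p, q, r, s, t]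
  value₁ : O q r s t = η
  value₂ : O p r s t = -η
  value₃ : O p q s t = η
  value₄ : O p q r t = -η
  value₅ : O p q r s = η
  weight₁ : μ p = η * affineDet ![x q, x r, x s, x t]
  weight₂ : μ q = -η * affineDet ![x p, x r, x s, x t]
  weight₃ : μ r = η * affineDet ![x p, x q, x s, x t]
  weight₄ : μ s = -η * affineDet ![x p, x q, x r, x t]
  weight₅ : μ t = η * affineDet ![x p, x q, x r, x s]
  weight_eq_zero : ∀ v, v ∉ [p, q, r, s, t] → μ v = 0
  prod : μ p * μ q * μ r * μ s * μ t = M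
  ne_zero : M ≠ 0

lemma affineDet_swap₂₃ (a b c d : E3) :
    affineDet ![a, c, b, d] = -affineDet ![a, b, c, d] := by
  simp only [affineDet_eq]
  ring

lemma affineDet_swap₁₂ (a b c d : E3) :
    affineDet ![b, a, c, d] = -affineDet ![a, b, c, d] := by
  simp only [affineDet_eq]
  ring

lemma affineDet_swap₃₄ (a b c d : E3) :
    affineDet ![a, b, d, c] = -affineDet ![a, b, c, d] := by
  simp only [affineDet_eq]
  ring

namespace IsSimplexBoundary

variable {V : Type*} {O : V → V → V → V → ℝ} {x : V → E3} {μ : V → ℝ} {M η : ℝ} {p q r s t : V}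

/-- A transposition of vertices flips `η` but leaves `μ` and `M` alone. The four adjacent
transpositions allow any edge to be put first, so one computation serves all ten edges. -/
lemma swap_first (h : IsSimplexBoundary O x μ M η p q r s t) :
    IsSimplexBoundary O x μ M (-η) q p r s t := by
  have hp : [q, p, r, s, t].Perm [p, q, r, s, t] := .swap _ _ _
  refine ⟨by rw [neg_sq, h.sq], hp.nodup_iff.mpr h.nodup, h.swap₁₂, h.swap₂₃, h.swap₃₄,
    fun a b c d hO _ hv => hp.symm.subset (h.support a b c d hO hv), ?_, ?_, ?_, ?_, ?_, ?_, ?_, ?_,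
    ?_, ?_, fun v hv => h.weight_eq_zero v fun hv' => hv (hp.symm.subset hv'), ?_, h.ne_zero⟩
  · rw [h.value₂]
  · rw [h.value₁, neg_neg]
  · rw [h.swap₁₂, h.value₃]
  · rw [h.swap₁₂, h.value₄]
  · rw [h.swap₁₂, h.value₅]
  · rw [h.weight₂]
  · rw [h.weight₁, neg_neg]
  · rw [h.weight₃, affineDet_swap₁₂]
    ring
  · rw [h.weight₄, affineDet_swap₁₂]
    ring
  · rw [h.weight₅, affineDet_swap₁₂]
    ring
  · rw [← h.prod]
    ring

lemma swap_second (h : IsSimplexBoundary O x μ M η p q r s t) :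
    IsSimplexBoundary O x μ M (-η) p r q s t := by
  have hp : [p, r, q, s, t].Perm [p, q, r, s, t] := .cons _ (.swap _ _ _)
  refine ⟨by rw [neg_sq, h.sq], hp.nodup_iff.mpr h.nodup, h.swap₁₂, h.swap₂₃, h.swap₃₄,
    fun a b c d hO _ hv => hp.symm.subset (h.support a b c d hO hv), ?_, ?_, ?_, ?_, ?_, ?_, ?_, ?_,
    ?_, ?_, fun v hv => h.weight_eq_zero v fun hv' => hv (hp.symm.subset hv'), ?_, h.ne_zero⟩
  · rw [h.swap₁₂, h.value₁]
  · rw [h.value₃, neg_neg]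
  · rw [h.value₂]
  · rw [h.swap₂₃, h.value₄]
  · rw [h.swap₂₃, h.value₅]
  · rw [h.weight₁, affineDet_swap₁₂]
    ring
  · rw [h.weight₃, neg_neg]
  · rw [h.weight₂]
  · rw [h.weight₄, affineDet_swap₂₃]
    ring
  · rw [h.weight₅, affineDet_swap₂₃]
    ring
  · rw [← h.prod]
    ring

lemma swap_third (h : IsSimplexBoundary O x μ M η p q r s t) :
    IsSimplexBoundary O x μ M (-η) p q s r t := by
  have hp : [p, q, s, r, t].Perm [p, q, r, s, t] := .cons _ (.cons _ (.swap _ _ _))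
  refine ⟨by rw [neg_sq, h.sq], hp.nodup_iff.mpr h.nodup, h.swap₁₂, h.swap₂₃, h.swap₃₄,
    fun a b c d hO _ hv => hp.symm.subset (h.support a b c d hO hv), ?_, ?_, ?_, ?_, ?_, ?_, ?_, ?_,
    ?_, ?_, fun v hv => h.weight_eq_zero v fun hv' => hv (hp.symm.subset hv'), ?_, h.ne_zero⟩
  · rw [h.swap₂₃, h.value₁]
  · rw [h.swap₂₃, h.value₂]
  · rw [h.value₄]
  · rw [h.value₃, neg_neg]
  · rw [h.swap₃₄, h.value₅]
  · rw [h.weight₁, affineDet_swap₂₃]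
    ring
  · rw [h.weight₂, affineDet_swap₂₃]
    ring
  · rw [h.weight₄]
  · rw [h.weight₃, neg_neg]
  · rw [h.weight₅, affineDet_swap₃₄]
    ring
  · rw [← h.prod]
    ring

lemma swap_fourth (h : IsSimplexBoundary O x μ M η p q r s t) :
    IsSimplexBoundary O x μ M (-η) p q r t s := by
  have hp : [p, q, r, t, s].Perm [p, q, r, s, t] := .cons _ (.cons _ (.cons _ (.swap _ _ _)))
  refine ⟨by rw [neg_sq, h.sq], hp.nodup_iff.mpr h.nodup, h.swap₁₂, h.swap₂₃, h.swap₃₄,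
    fun a b c d hO _ hv => hp.symm.subset (h.support a b c d hO hv), ?_, ?_, ?_, ?_, ?_, ?_, ?_, ?_,
    ?_, ?_, fun v hv => h.weight_eq_zero v fun hv' => hv (hp.symm.subset hv'), ?_, h.ne_zero⟩
  · rw [h.swap₃₄, h.value₁]
  · rw [h.swap₃₄, h.value₂]
  · rw [h.swap₃₄, h.value₃]
  · rw [h.value₅, neg_neg]
  · rw [h.value₄]
  · rw [h.weight₁, affineDet_swap₃₄]
    ring
  · rw [h.weight₂, affineDet_swap₃₄]
    ring
  · rw [h.weight₃, affineDet_swap₃₄]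
    ring
  · rw [h.weight₅, neg_neg]
  · rw [h.weight₄]
  · rw [← h.prod]
    ring

lemma exists_first (h : IsSimplexBoundary O x μ M η p q r s t) {a : V}
    (ha : a ∈ [p, q, r, s, t]) : ∃ η' b c d e, IsSimplexBoundary O x μ M η' a b c d e := by
  simp only [List.mem_cons, List.not_mem_nil, or_false] at ha
  rcases ha with rfl | rfl | rfl | rfl | rfl
  · exact ⟨_, _, _, _, _, h⟩
  · exact ⟨_, _, _, _, _, h.swap_first⟩
  · exact ⟨_, _, _, _, _, h.swap_second.swap_first⟩
  · exact ⟨_, _, _, _, _, h.swap_third.swap_second.swap_first⟩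
  · exact ⟨_, _, _, _, _, h.swap_fourth.swap_third.swap_second.swap_first⟩

lemma exists_second (h : IsSimplexBoundary O x μ M η p q r s t) {a : V}
    (ha : a ∈ [q, r, s, t]) : ∃ η' c d e, IsSimplexBoundary O x μ M η' p a c d e := by
  simp only [List.mem_cons, List.not_mem_nil, or_false] at ha
  rcases ha with rfl | rfl | rfl | rfl
  · exact ⟨_, _, _, _, h⟩
  · exact ⟨_, _, _, _, h.swap_second⟩
  · exact ⟨_, _, _, _, h.swap_third.swap_second⟩
  · exact ⟨_, _, _, _, h.swap_fourth.swap_third.swap_second⟩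

/-- As the product `M` of the weights is nonzero, the support of `μ` is the vertex set, described
without reference to an ordering. -/
lemma mem_iff_of_perm (h : IsSimplexBoundary O x μ M η p q r s t) (v : V) :
    v ∈ [p, q, r, s, t] ↔ μ v ≠ 0 := by
  refine ⟨fun hv => ?_, fun hv => by_contra fun hv' => hv (h.weight_eq_zero v hv')⟩
  have hne := h.ne_zero
  rw [← h.prod] at hne
  simp only [mul_ne_zero_iff] at hne
  obtain ⟨⟨⟨⟨h1, h2⟩, h3⟩, h4⟩, h5⟩ := hne
  simp only [List.mem_cons, List.not_mem_nil, or_false] at hv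
  rcases hv with rfl | rfl | rfl | rfl | rfl <;> assumption

lemma exists_first_second (h : IsSimplexBoundary O x μ M η p q r s t) {a b : V}
    (ha : μ a ≠ 0) (hb : μ b ≠ 0) (hab : a ≠ b) :
    ∃ η' c d e, IsSimplexBoundary O x μ M η' a b c d e := by
  obtain ⟨_, _, _, _, _, h'⟩ := h.exists_first ((h.mem_iff_of_perm a).mpr ha)
  refine h'.exists_second ?_
  have := (h'.mem_iff_of_perm b).mpr hb
  exact (List.mem_cons.mp this).resolve_left hab.symm

end IsSimplexBoundary

/-- The product of the length of an edge and the values of `μ` at its ends. -/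
def edgeWeight {V : Type*} (x : V → E3) (μ : V → ℝ) : Sym2 V → ℝ :=
  Sym2.lift ⟨fun p q => dist (x p) (x q) * (μ p * μ q), fun p q => by
    simp only [dist_comm (x p), mul_comm (μ p)]⟩

lemma edgeWeight_mk {V : Type*} (x : V → E3) (μ : V → ℝ) (p q : V) :
    edgeWeight x μ s(p, q) = edgeLength x s(p, q) * (μ p * μ q) := rfl

namespace IsSimplexBoundary

variable {V : Type*} {O : V → V → V → V → ℝ} {x : V → E3} {μ : V → ℝ} {M η : ℝ} {p q r s t : V}

/-- `g` is supported at `b`, so at most one term survives. If `b` is a loop or leaves the simplex,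
both sides vanish: `edgeWeight` contains the length and both values of `μ`. -/
lemma sum_weights [DecidableEq V] (h : IsSimplexBoundary O x μ M η p q r s t) (b : Sym2 V)
    (g : Sym2 V → ℝ) (hg : ∀ e, g e = 2 * edgeLength x e * if e = b then 1 else 0) :
    μ p * μ q * g s(p, q) + μ p * μ r * g s(p, r) + μ p * μ s * g s(p, s) + μ p * μ t * g s(p, t) +
      μ q * μ r * g s(q, r) + μ q * μ s * g s(q, s) + μ q * μ t * g s(q, t) +
      μ r * μ s * g s(r, s) + μ s * μ t * g s(s, t) + μ t * μ r * g s(t, r) =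
      2 * edgeWeight x μ b := by
  have hn := h.nodup
  simp only [List.nodup_cons, List.mem_cons, List.not_mem_nil, or_false, not_or, not_false_eq_true,
    List.nodup_nil, and_true] at hn
  obtain ⟨⟨hpq, hpr, hps, hpt⟩, ⟨hqr, hqs, hqt⟩, ⟨hrs, hrt⟩, hst⟩ := hn
  have aux : ∀ u v : V, μ u * μ v * g s(u, v) = if b = s(u, v) then 2 * edgeWeight x μ b else 0 := by
    intro u v
    rw [hg]
    by_cases hb : b = s(u, v)
    · subst hb
      simp only [if_true, edgeWeight_mk]
      ring
    · rw [if_neg hb, if_neg (Ne.symm hb)]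
      ring
  simp only [aux]
  induction b with | _ u v =>
  by_cases hu : u ∈ [p, q, r, s, t]
  · by_cases hv : v ∈ [p, q, r, s, t]
    · have h0 : ∀ w, edgeWeight x μ s(w, w) = 0 := fun w => by
        rw [edgeWeight_mk, edgeLength_self, zero_mul]
      simp only [List.mem_cons, List.not_mem_nil, or_false] at hu hv
      rcases hu with rfl | rfl | rfl | rfl | rfl <;> rcases hv with rfl | rfl | rfl | rfl | rfl <;>
        simp [h0, hpq, hpr, hps, hpt, hqr, hqs, hqt, hrs, hrt, hst, Ne.symm hpq,
          Ne.symm hpr, Ne.symm hps, Ne.symm hpt, Ne.symm hqr, Ne.symm hqs, Ne.symm hqt, Ne.symm hrs,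
          Ne.symm hrt, Ne.symm hst]
    · simp [edgeWeight_mk, h.weight_eq_zero v hv]
  · simp [edgeWeight_mk, h.weight_eq_zero u hu]

/-- Only the edges opposite to `pq` in its three faces contribute; in the cyclic order `rs`, `st`,
`tr` all three signs equal `η`. -/
lemma sum_eq [Fintype V] [DecidableEq V] (h : IsSimplexBoundary O x μ M η p q r s t)
    (f : Sym2 V → ℝ) (F : V → V → ℝ) (hf : ∀ a b, f s(a, b) = O p q a b * F a b) :
    ∑ c, f c = η * (F r s + F s t + F t r) := by
  have hn := h.nodup
  simp only [List.nodup_cons, List.mem_cons, List.not_mem_nil, or_false, not_or, not_false_eq_true,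
    List.nodup_nil, and_true] at hn
  obtain ⟨⟨hpq, hpr, hps, hpt⟩, ⟨hqr, hqs, hqt⟩, ⟨hrs, hrt⟩, hst⟩ := hn
  have h1 : s(r, s) ∉ ({s(s, t), s(t, r)} : Finset (Sym2 V)) := by
    simp [hrs, hrt, hst]
  have h2 : s(s, t) ∉ ({s(t, r)} : Finset (Sym2 V)) := by
    simp [Ne.symm hrs, hst]
  rw [← Finset.sum_subset (Finset.subset_univ {s(r, s), s(s, t), s(t, r)}), Finset.sum_insert h1,
    Finset.sum_insert h2, Finset.sum_singleton, hf, hf, hf, h.value₅, h.value₃, h.swap₃₄ p q r t,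
    h.value₄]
  · ring
  intro c _ hc
  induction c with | _ u v =>
  rw [hf]
  by_cases hO : O p q u v = 0
  · rw [hO, zero_mul]
  exfalso
  have hs := h.support p q u v hO
  have hu := hs (show u ∈ [p, q, u, v] by simp)
  have hv := hs (show v ∈ [p, q, u, v] by simp)
  -- Alternation makes `O` vanish on repeated vertices, which leaves only the three opposite edges.
  have huv : u ≠ v := by
    rintro rfl
    have := h.swap₃₄ p q u u
    exact hO (by linarith)
  have hqu : q ≠ u := by
    rintro rfl
    have := h.swap₂₃ p q q v
    exact hO (by linarith)
  have hqv : q ≠ v := by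
    rintro rfl
    have := h.swap₂₃ p q q u
    have := h.swap₃₄ p q q u
    exact hO (by linarith)
  have hpu : p ≠ u := by
    rintro rfl
    have := h.swap₁₂ p p q v
    have := h.swap₂₃ p p q v
    exact hO (by linarith)
  have hpv : p ≠ v := by
    rintro rfl
    have := h.swap₁₂ p p q u
    have := h.swap₂₃ p p q u
    have := h.swap₃₄ p q p u
    exact hO (by linarith)
  simp only [List.mem_cons, List.not_mem_nil, or_false] at hu hv
  rcases hu with rfl | rfl | rfl | rfl | rfl <;> rcases hv with rfl | rfl | rfl | rfl | rfl <;>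
    first
    | contradiction
    | simp [Sym2.eq_swap] at hc

end IsSimplexBoundary

/-! ### The rank one formula for the change of the matrix. -/

namespace OrientedComplex

variable {V : Type*} [Fintype V] [DecidableEq V] {K K' : OrientedComplex V} {x : V → E3}
  {μ : V → ℝ} {M η : ℝ} {p q r s t : V}

lemma curvDeriv_sub (hx : K.Permitted x) (hx' : K'.Permitted x) (a b : Sym2 V) :
    K'.curvDeriv x a b - K.curvDeriv x a b =
      -∑ c, (K'.signedRate x b a c - K.signedRate x b a c) := by
  rw [curvDeriv_eq_neg_sum _ hx, curvDeriv_eq_neg_sum _ hx', Finset.sum_sub_distrib]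
  ring

/-- Common tetrahedra cancel, leaving the three faces of the simplex around `pq`. The length in the
denominator of each angle rate reduces `l_pq²` to `l_pq`, and `1 / (μ r * μ s * μ t) = μ p * μ q /
M` makes the result symmetric. -/
lemma curvDeriv_sub_first (hx : K.Permitted x) (hx' : K'.Permitted x)
    (h : IsSimplexBoundary (fun a b c d => (K'.orient a b c d : ℝ) - K.orient a b c d) x μ M η
      p q r s t) (b : Sym2 V) :
    K'.curvDeriv x s(p, q) b - K.curvDeriv x s(p, q) b =
      -M⁻¹ * edgeWeight x μ s(p, q) * edgeWeight x μ b := by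
  rw [curvDeriv_sub hx hx', h.sum_eq _ (dihedralRate x b p q) (by
    intro u v
    rw [signedRate_mk _ hx', signedRate_mk _ hx]
    ring)]
  have hM := h.ne_zero
  rw [← h.prod] at hM
  simp only [mul_ne_zero_iff] at hM
  obtain ⟨⟨⟨⟨h1, h2⟩, h3⟩, h4⟩, h5⟩ := hM
  have hη : η * η = 1 := by rw [← sq, h.sq]
  have hη0 : η ≠ 0 := left_ne_zero_of_mul_eq_one hη
  have hw : ∀ m d : ℝ, m = η * d → d = η * m := by
    rintro m d rfl
    rw [← mul_assoc, hη, one_mul]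
  have hw' : ∀ m d : ℝ, m = -η * d → -d = η * m := by
    rintro m d rfl
    linear_combination d * hη
  have ht := hw _ _ h.weight₅
  have hs := hw' _ _ h.weight₄
  have hr := hw _ _ h.weight₃
  have hq := hw' _ _ h.weight₂
  have hp := hw _ _ h.weight₁
  have key := sum_angleRate_div_affineDet x
    (fun e => 2 * edgeLength x e * if e = b then 1 else 0) p q r s t
    (ht ▸ mul_ne_zero hη0 h5) (neg_ne_zero.mp (hs ▸ mul_ne_zero hη0 h4)) (hr ▸ mul_ne_zero hη0 h3)
    _ _ _ _ _ hp.symm hq.symm hr.symm hs.symm ht.symm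
  have hsum := h.sum_weights b _ fun e => rfl
  have hl : edgeLength x s(p, q) ≠ 0 := by
    have := (ne_of_affineDet_ne_zero (ht ▸ mul_ne_zero hη0 h5)).1
    simpa [edgeLength] using this
  -- Passing from signed volumes to `μ` gives `η²` above and `η³` below; the surplus `η` cancels
  -- against the one from `sum_eq`.
  have key' := key.trans (show _ = -(edgeLength x s(p, q) ^ 2 /
    (2 * (η * μ r * (η * μ s) * (η * μ t)))) * (η * η * (2 * edgeWeight x μ b)) by
      rw [← hsum]
      ring)
  have hrate : ∀ u v, dihedralRate x b p q u v = -(edgeLength x s(p, q))⁻¹ *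
      (angleRate (fun e => edgeLength x e ^ 2)
        (fun e => 2 * edgeLength x e * if e = b then 1 else 0) p q u v /
        affineDet ![x p, x q, x u, x v]) := by
    intro u v
    rw [dihedralRate]
    ring
  rw [hrate, hrate, hrate, ← mul_add, ← mul_add, key', edgeWeight_mk, ← h.prod]
  field_simp

/-- An edge of the simplex can be put first. For any other pair no tetrahedron containing it has
changed, and `edgeWeight` is zero as well. -/
lemma curvDeriv_eq_add (hx : K.Permitted x) (hx' : K'.Permitted x)
    (h : IsSimplexBoundary (fun a b c d => (K'.orient a b c d : ℝ) - K.orient a b c d) x μ M η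
      p q r s t) (a b : Sym2 V) :
    K'.curvDeriv x a b = K.curvDeriv x a b - M⁻¹ * edgeWeight x μ a * edgeWeight x μ b := by
  induction a with | _ u v =>
  by_cases huv : u ≠ v ∧ μ u ≠ 0 ∧ μ v ≠ 0
  · obtain ⟨_, _, _, _, h'⟩ := h.exists_first_second huv.2.1 huv.2.2 huv.1
    linear_combination curvDeriv_sub_first hx hx' h' b
  have hw : edgeWeight x μ s(u, v) = 0 := by
    rw [edgeWeight_mk]
    by_cases hu : u = v
    · rw [hu, edgeLength_self, zero_mul]
    · simp only [ne_eq, hu, not_false_eq_true, true_and, not_and_or, not_not] at huv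
      rcases huv with h | h <;> simp [h]
  have hz : K'.curvDeriv x s(u, v) b - K.curvDeriv x s(u, v) b = 0 := by
    rw [curvDeriv_sub hx hx', neg_eq_zero]
    refine Finset.sum_eq_zero fun c _ => ?_
    induction c with | _ w z =>
    rw [signedRate_mk _ hx', signedRate_mk _ hx, ← sub_mul]
    by_cases hO : (K'.orient u v w z : ℝ) - K.orient u v w z = 0
    · rw [hO, zero_mul]
    refine absurd ⟨?_, ?_, ?_⟩ huv
    · rintro rfl
      have := h.swap₁₂ u u w z
      exact hO (by linarith)
    · exact (h.mem_iff_of_perm u).mp (h.support u v w z hO (by simp))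
    · exact (h.mem_iff_of_perm v).mp (h.support u v w z hO (by simp))
  rw [hw]
  linear_combination hz

end OrientedComplex

/-! ### Minors and ranks under a rank one perturbation. -/

/-- Row `d` of `a'` is `-c * w d * w`. Subtracting `w i / w d` times it from row `i` restores `a`
and clears column `d`; the factorisation into block triangular matrices records this elimination. -/
lemma det_insert_of_sub_mul {ι : Type*} [DecidableEq ι] (S : Finset ι) {d : ι} (hd : d ∉ S)
    (a a' : ι → ι → ℝ) (w : ι → ℝ) (c : ℝ) (h : ∀ i j, a' i j = a i j - c * w i * w j)
    (hrow : ∀ j, a d j = 0) (hcol : ∀ i, a i d = 0) (hw : w d ≠ 0) :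
    Matrix.det (Matrix.of fun i j : ↥(insert d S) => a' i j) =
      -c * w d ^ 2 * Matrix.det (Matrix.of fun i j : S => a i j) := by
  let e : S ⊕ Unit ≃ ↥(insert d S) :=
    (Equiv.optionEquivSumPUnit S).symm.trans (Finset.subtypeInsertEquivOption hd).symm
  have e₁ : ∀ i : S, ((e (Sum.inl i) : ↥(insert d S)) : ι) = i := fun i => by
    simp [e, Finset.subtypeInsertEquivOption]
  have e₂ : ∀ i : Unit, ((e (Sum.inr i) : ↥(insert d S)) : ι) = d := fun i => by
    simp [e, Finset.subtypeInsertEquivOption]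
  rw [← Matrix.det_submatrix_equiv_self e]
  have hfac : (Matrix.of fun i j : ↥(insert d S) => a' i j).submatrix e e =
      Matrix.fromBlocks 1 (Matrix.of fun (i : S) (_ : Unit) => w i / w d) 0 1 *
      Matrix.fromBlocks (Matrix.of fun i j : S => a i j) 0
        (Matrix.of fun (_ : Unit) (j : S) => -c * w d * w j)
        (Matrix.of fun (_ _ : Unit) => -c * w d ^ 2) := by
    rw [Matrix.fromBlocks_multiply]
    ext i j
    rcases i with i | i <;> rcases j with j | j <;>
      simp [e₁, e₂, h, hrow, hcol, Matrix.mul_apply] <;>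
      field_simp <;>
      ring
  rw [hfac, Matrix.det_mul, Matrix.det_fromBlocks_zero₂₁, Matrix.det_fromBlocks_zero₁₂]
  simp
  ring

lemma rank_add_le_add {m n : Type*} [Fintype m] [Fintype n] (A B : Matrix m n ℝ) :
    (A + B).rank ≤ A.rank + B.rank := by
  have h : LinearMap.range (A + B).mulVecLin ≤
      LinearMap.range A.mulVecLin ⊔ LinearMap.range B.mulVecLin := by
    rw [Matrix.mulVecLin_add]
    exact LinearMap.range_add_le _ _
  exact (Submodule.finrank_mono h).trans (Submodule.finrank_add_le_finrank_add_finrank _ _)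

/-- Since `a` lives on `E × E`, its block on `E'` is `P A Pᵀ` with `P` the 0-1 incidence matrix of
`E'` and `E`. No inclusion between the two sets is needed. -/
lemma rank_extend_le {ι : Type*} [DecidableEq ι] (E E' : Finset ι) (a : ι → ι → ℝ)
    (hrow : ∀ i j, i ∉ E → a i j = 0) (hcol : ∀ i j, j ∉ E → a i j = 0) :
    (Matrix.of fun i j : E' => a i j).rank ≤ (Matrix.of fun i j : E => a i j).rank := by
  have hsum : ∀ (i : ι) (f : ι → ℝ),
      ∑ k : E, (if i = (k : ι) then 1 else 0) * f k = if i ∈ E then f i else 0 := by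
    intro i f
    rw [Finset.sum_coe_sort E fun k => (if i = k then 1 else 0) * f k]
    simp
  let P : Matrix E' E ℝ := Matrix.of fun i k => if (i : ι) = k then 1 else 0
  have hA : (Matrix.of fun i j : E' => a i j) =
      P * ((Matrix.of fun i j : E => a i j) * P.transpose) := by
    ext i j
    simp only [Matrix.mul_apply, P, Matrix.of_apply, Matrix.transpose_apply]
    simp only [mul_comm (a _ _), hsum j, hsum i fun k => if (j : ι) ∈ E then a k j else 0]
    split_ifs with h1 h2
    · rfl
    · exact hcol _ _ h2
    · exact hrow _ _ h1
  rw [hA]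
  exact (Matrix.rank_mul_le_right _ _).trans (Matrix.rank_mul_le_left _ _)

lemma rank_sub_mul_le {ι : Type*} [DecidableEq ι] (E E' : Finset ι) (a a' : ι → ι → ℝ)
    (w : ι → ℝ) (c : ℝ) (h : ∀ i j, a' i j = a i j - c * w i * w j)
    (hrow : ∀ i j, i ∉ E → a i j = 0) (hcol : ∀ i j, j ∉ E → a i j = 0) :
    (Matrix.of fun i j : E' => a' i j).rank ≤ (Matrix.of fun i j : E => a i j).rank + 1 := by
  have hA : (Matrix.of fun i j : E' => a' i j) = (Matrix.of fun i j : E' => a i j) +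
      Matrix.vecMulVec (fun i : E' => -c * w i) (fun j : E' => w j) := by
    ext i j
    simp [Matrix.vecMulVec, h]
    ring
  rw [hA]
  exact (rank_add_le_add _ _).trans
    (add_le_add (rank_extend_le E E' a hrow hcol) (Matrix.rank_vecMulVec_le _ _))

lemma card_le_rank_of_det_ne_zero {ι : Type*} [DecidableEq ι] (S E : Finset ι) (hS : S ⊆ E)
    (a : ι → ι → ℝ) (h : Matrix.det (Matrix.of fun i j : S => a i j) ≠ 0) :
    S.card ≤ (Matrix.of fun i j : E => a i j).rank := by
  have h1 := Matrix.rank_of_det_ne_zero h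
  rw [Fintype.card_coe] at h1
  rw [← h1]
  exact Matrix.rank_submatrix_le (Matrix.of fun i j : E => a i j)
    (fun i : S => (⟨i, hS i.2⟩ : E)) fun i : S => (⟨i, hS i.2⟩ : E)

/-! ### Volumes, tetrahedra and edges of a complex. -/

/-- Two enumerations of the vertices differ by a permutation of the rows, which affects the
determinant only by a sign. -/
lemma tetVolume_eq {V : Type*} [DecidableEq V] (x : V → E3) {p q r s : V}
    (h : [p, q, r, s].Nodup) :
    6 * tetVolume x {p, q, r, s} = |affineDet ![x p, x q, x r, x s]| := by
  have hc : ({p, q, r, s} : Finset V).card = 4 := by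
    have := List.toFinset_card_of_nodup h
    simpa using this
  rw [tetVolume, dif_pos hc]
  let f : Fin 4 → ({p, q, r, s} : Finset V) :=
    ![⟨p, by simp⟩, ⟨q, by simp⟩, ⟨r, by simp⟩, ⟨s, by simp⟩]
  have hf : Function.Injective f := by
    have hn := h
    simp only [List.nodup_cons, List.mem_cons, List.not_mem_nil, or_false, not_or] at hn
    intro i j hij
    have hij' := congrArg Subtype.val hij
    fin_cases i <;> fin_cases j <;> simp [f] at hij' ⊢ <;> simp_all
  let e := Finset.equivFinOfCardEq hc
  let σ : Equiv.Perm (Fin 4) := Equiv.ofBijective (fun i => e (f i))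
    (Finite.injective_iff_bijective.mp (e.injective.comp hf))
  have hσ : (fun i => (e.symm (σ i) : V)) = ![p, q, r, s] := by
    ext i
    fin_cases i <;> simp [σ, f]
  have hdet := Matrix.det_permute σ (Matrix.of fun i : Fin 4 =>
    ![1, x (e.symm i) 0, x (e.symm i) 1, x (e.symm i) 2])
  have hl : ((Matrix.of fun i : Fin 4 =>
      ![1, x (e.symm i) 0, x (e.symm i) 1, x (e.symm i) 2]).submatrix σ id).det =
      affineDet ![x p, x q, x r, x s] := by
    rw [affineDet]
    congr 1
    ext i j
    have := congrFun hσ i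
    simp only [Matrix.submatrix_apply, Matrix.of_apply, id, this]
    fin_cases i <;> rfl
  rw [← hl, hdet, abs_mul]
  have hs : |((Equiv.Perm.sign σ : ℤ) : ℝ)| = 1 := by
    rcases Int.units_eq_one_or (Equiv.Perm.sign σ) with h | h <;> simp [h]
  rw [hs, one_mul]
  simp only [affineDet, e]
  ring

lemma SignType.neg_ne_zero_iff {z : SignType} : -z ≠ 0 ↔ z ≠ 0 := by
  revert z
  decide

namespace OrientedComplex

variable {V : Type*} {K K' : OrientedComplex V} {p q r s : V}

lemma nodup_of_orient_ne_zero (h : K.orient p q r s ≠ 0) : [p, q, r, s].Nodup := by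
  have hz : ∀ z : SignType, z = -z → z = 0 := by decide
  have h12 : ∀ a c d, K.orient a a c d = 0 := fun a c d => hz _ (K.swap₁₂ a a c d)
  have h23 : ∀ a c d, K.orient c a a d = 0 := fun a c d => hz _ (K.swap₂₃ c a a d)
  have h34 : ∀ a c d, K.orient c d a a = 0 := fun a c d => hz _ (K.swap₃₄ c d a a)
  simp only [List.nodup_cons, List.mem_cons, List.not_mem_nil, or_false, not_or, not_false_eq_true,
    List.nodup_nil, and_true]
  refine ⟨⟨?_, ?_, ?_⟩, ⟨?_, ?_⟩, ?_⟩ <;> rintro rfl <;> apply h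
  · exact h12 _ _ _
  · rw [K.swap₂₃, h12, neg_zero]
  · rw [K.swap₃₄, K.swap₂₃, h12, neg_zero, neg_zero]
  · exact h23 _ _ _
  · rw [K.swap₃₄, h23, neg_zero]
  · exact h34 _ _ _

variable [Fintype V] [DecidableEq V]

lemma mem_tets (h : K.orient p q r s ≠ 0) : {p, q, r, s} ∈ K.tets := by
  simp only [tets, Finset.mem_filter, Finset.mem_univ, true_and]
  exact ⟨p, q, r, s, h, rfl⟩

lemma exists_of_mem_tets {t : Finset V} (h : t ∈ K.tets) :
    ∃ p q r s, K.orient p q r s ≠ 0 ∧ t = {p, q, r, s} := by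
  simpa only [tets, Finset.mem_filter, Finset.mem_univ, true_and] using h

lemma mem_edges_iff {e : Sym2 V} :
    e ∈ K.edges ↔ ∃ p q r s, K.orient p q r s ≠ 0 ∧ e = s(p, q) := by
  simp only [edges, Finset.mem_filter, Finset.mem_univ, true_and]

lemma mem_edges₁₂ (h : K.orient p q r s ≠ 0) : s(p, q) ∈ K.edges :=
  mem_edges_iff.mpr ⟨p, q, r, s, h, rfl⟩

lemma mem_edges_of_mem (h : K.orient p q r s ≠ 0) {a b : V} (ha : a ∈ ({p, q, r, s} : Finset V))
    (hb : b ∈ ({p, q, r, s} : Finset V)) (hab : a ≠ b) : s(a, b) ∈ K.edges := by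
  have e12 : s(p, q) ∈ K.edges := mem_edges₁₂ h
  have h23 : K.orient p r q s ≠ 0 := by rwa [K.swap₂₃, SignType.neg_ne_zero_iff]
  have h24 : K.orient p s q r ≠ 0 := by rwa [K.swap₂₃, K.swap₃₄, neg_neg]
  have e13 : s(p, r) ∈ K.edges := mem_edges₁₂ h23
  have e14 : s(p, s) ∈ K.edges := mem_edges₁₂ h24
  have e23 : s(q, r) ∈ K.edges :=
    mem_edges₁₂ (r := p) (s := s) (by rwa [K.swap₂₃, K.swap₁₂, neg_neg])
  have e24 : s(q, s) ∈ K.edges :=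
    mem_edges₁₂ (r := p) (s := r) (by rwa [K.swap₂₃, K.swap₁₂, K.swap₃₄, neg_neg, SignType.neg_ne_zero_iff])
  have e34 : s(r, s) ∈ K.edges :=
    mem_edges₁₂ (r := p) (s := q) (by rwa [K.swap₂₃, K.swap₁₂, K.swap₃₄, K.swap₂₃, neg_neg, neg_neg])
  simp only [Finset.mem_insert, Finset.mem_singleton] at ha hb
  rcases ha with rfl | rfl | rfl | rfl <;> rcases hb with rfl | rfl | rfl | rfl <;>
    first
    | exact absurd rfl hab
    | assumption
    | (rw [Sym2.eq_swap]; assumption)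

lemma curvDeriv_eq_zero_of_left {x : V → E3} (hx : K.Permitted x) {a : Sym2 V} (ha : a ∉ K.edges)
    (b : Sym2 V) : K.curvDeriv x a b = 0 := by
  rw [curvDeriv_eq_neg_sum _ hx, neg_eq_zero]
  refine Finset.sum_eq_zero fun c _ => ?_
  induction a with | _ p q =>
  induction c with | _ r s =>
  rw [signedRate_mk _ hx]
  by_cases h : K.orient p q r s = 0
  · simp [h]
  · exact absurd (mem_edges₁₂ h) ha

lemma curvDeriv_eq_zero_of_right {x : V → E3} (hx : K.Permitted x) (a : Sym2 V) {b : Sym2 V}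
    (hb : b ∉ K.edges) : K.curvDeriv x a b = 0 := by
  rw [curvDeriv_eq_neg_sum _ hx, neg_eq_zero]
  refine Finset.sum_eq_zero fun c _ => ?_
  induction a with | _ p q =>
  induction c with | _ r s =>
  rw [signedRate_mk _ hx]
  by_cases h : K.orient p q r s = 0
  · simp [h]
  have hn := nodup_of_orient_ne_zero h
  simp only [List.nodup_cons, List.mem_cons, List.not_mem_nil, or_false, not_or] at hn
  have hne : ∀ u v, u ∈ ({p, q, r, s} : Finset V) → v ∈ ({p, q, r, s} : Finset V) → u ≠ v →
      s(u, v) ≠ b := fun u v hu hv huv e => hb (e ▸ mem_edges_of_mem h hu hv huv)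
  rw [dihedralRate, angleRate, if_neg (hne p q (by simp) (by simp) hn.1.1),
    if_neg (hne p r (by simp) (by simp) hn.1.2.1), if_neg (hne p s (by simp) (by simp) hn.1.2.2),
    if_neg (hne q r (by simp) (by simp) hn.2.1.1), if_neg (hne q s (by simp) (by simp) hn.2.1.2),
    if_neg (hne r s (by simp) (by simp) hn.2.2.1)]
  simp

end OrientedComplex

/-! ### Combinatorics of the Pachner move. -/

namespace OrientedComplex.IsPachnerMove23

open OrientedComplex

variable {V : Type*} [Fintype V] [DecidableEq V] {K K' : OrientedComplex V} {A B C D E : V}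

lemma nodup (h : IsPachnerMove23 K K' A B C D E) : [A, B, C, D, E].Nodup := by
  have h1 := nodup_of_orient_ne_zero h.left
  have h2 := nodup_of_orient_ne_zero h.right
  have h3 := h.ne
  simp only [List.nodup_cons, List.mem_cons, List.not_mem_nil, or_false, not_or] at h1 h2 ⊢
  tauto

/-- The move does not depend on the choice of the first of the three vertices of the common face. -/
lemma rotate (h : IsPachnerMove23 K K' A B C D E) : IsPachnerMove23 K K' B C A D E where
  left := by rw [K.swap₂₃, K.swap₁₂, neg_neg]; exact h.left
  right := by rw [K.swap₂₃, K.swap₁₂, neg_neg]; exact h.right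
  ne := h.ne
  newEdge := h.newEdge
  tets_eq := by
    have e : ∀ X : V, ({B, C, A, X} : Finset V) = {A, B, C, X} := by
      intro X
      ext v
      simp only [Finset.mem_insert, Finset.mem_singleton]
      tauto
    rw [h.tets_eq, e, e]
    congr 1
    ext v
    simp only [Finset.mem_insert, Finset.mem_singleton]
    tauto
  orient_eq := h.orient_eq

lemma not_mem_tets_of_mem (h : IsPachnerMove23 K K' A B C D E) {t : Finset V} (hD : D ∈ t)
    (hE : E ∈ t) : t ∉ K.tets := by
  intro ht
  obtain ⟨p, q, r, s, ho, rfl⟩ := exists_of_mem_tets ht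
  exact h.newEdge (mem_edges_of_mem ho hD hE h.ne)

lemma mem_tets_iff (h : IsPachnerMove23 K K' A B C D E) {t : Finset V} :
    t ∈ K'.tets ↔ (t ∈ K.tets ∧ t ≠ {A, B, C, D} ∧ t ≠ {A, B, C, E}) ∨
      t = {A, B, D, E} ∨ t = {B, C, D, E} ∨ t = {C, A, D, E} := by
  rw [h.tets_eq]
  simp only [Finset.mem_union, Finset.mem_sdiff, Finset.mem_insert, Finset.mem_singleton, not_or]

/-- The tetrahedron `ABDE` of the new complex is attached to the boundary face `ABD` as `ABCD` was
in the old one. -/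
lemma orient_new (h : IsPachnerMove23 K K' A B C D E) :
    K'.orient A B D E = -K.orient A B C D := by
  have hn := h.nodup
  simp only [List.nodup_cons, List.mem_cons, List.not_mem_nil, or_false, not_or, not_false_eq_true,
    List.nodup_nil, and_true] at hn
  obtain ⟨⟨hAB, hAC, hAD, hAE⟩, ⟨hBC, hBD, hBE⟩, ⟨hCD, hCE⟩, hDE⟩ := hn
  have hABDC : K.orient A B D C ≠ 0 := by rw [K.swap₃₄, SignType.neg_ne_zero_iff]; exact h.left
  -- `X` is the apex across the face `ABD` from `C`. The tetrahedron `ABDX` survives the move, so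
  -- its new neighbour across `ABD` gets the sign that `ABDC` had.
  obtain ⟨X, hXC, hX, hXo⟩ := K.closed A B D C hABDC
  have hX0 : K.orient A B D X ≠ 0 := (hX X).mpr (Or.inr rfl)
  have keep : ∀ Y, Y ≠ C → ({A, B, D, Y} : Finset V) ∈ K.tets →
      ({A, B, D, Y} : Finset V) ∈ K'.tets := by
    intro Y hYC hY
    refine h.mem_tets_iff.mpr (Or.inl ⟨hY, ?_, ?_⟩)
    · intro e
      have : C ∈ ({A, B, D, Y} : Finset V) := e ▸ by simp
      simp [Ne.symm hAC, Ne.symm hBC, hCD, Ne.symm hYC] at this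
    · intro e
      have : D ∈ ({A, B, C, E} : Finset V) := e ▸ by simp
      simp [Ne.symm hAD, Ne.symm hBD, Ne.symm hCD, hDE] at this
  have hXt := mem_tets hX0
  have hX' : K'.orient A B D X = K.orient A B D X := h.orient_eq _ _ _ _ hXt (keep X hXC hXt)
  obtain ⟨Y, hYX, -, hYo⟩ := K'.closed A B D X (hX' ▸ hX0)
  have hY0 : K'.orient A B D Y ≠ 0 := by rw [hYo, SignType.neg_ne_zero_iff, hX']; exact hX0
  have hYt := mem_tets hY0
  -- An old neighbour would have apex `C` or `X`: the first tetrahedron was removed and the second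
  -- is `ABDX` itself. Of the new tetrahedra only `ABDE` contains `A`, `B` and `D`.
  have hYE : Y = E := by
    rcases h.mem_tets_iff.mp hYt with ⟨hY1, hY2, -⟩ | hY | hY | hY
    · have hY3 := h.orient_eq _ _ _ _ hY1 hYt
      rcases (hX Y).mp (hY3 ▸ hY0) with rfl | rfl
      · exact absurd (by rw [Finset.pair_comm]) hY2
      · exact absurd rfl hYX
    · have : E ∈ ({A, B, D, Y} : Finset V) := hY ▸ by simp
      simpa [Ne.symm hAE, Ne.symm hBE, Ne.symm hDE, eq_comm] using this
    · have : A ∈ ({B, C, D, E} : Finset V) := hY ▸ by simp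
      simp [hAB, hAC, hAD, hAE] at this
    · have : B ∈ ({C, A, D, E} : Finset V) := hY ▸ by simp
      simp [hBC, Ne.symm hAB, hBD, hBE] at this
  rw [← hYE, hYo, hX', hXo, neg_neg, K.swap₃₄]

lemma orient_right (h : IsPachnerMove23 K K' A B C D E) :
    K.orient A B C E = -K.orient A B C D := by
  obtain ⟨X, -, hX, hXo⟩ := K.closed A B C D h.left
  rcases (hX E).mp h.right with e | rfl
  · exact absurd e h.ne.symm
  · exact hXo

lemma orient_old (h : IsPachnerMove23 K K' A B C D E) :
    K'.orient A B C D = 0 ∧ K'.orient A B C E = 0 := by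
  have hn := h.nodup
  simp only [List.nodup_cons, List.mem_cons, List.not_mem_nil, or_false, not_or, not_false_eq_true,
    List.nodup_nil, and_true] at hn
  obtain ⟨⟨hAB, hAC, hAD, hAE⟩, ⟨hBC, hBD, hBE⟩, ⟨hCD, hCE⟩, hDE⟩ := hn
  constructor <;> by_contra h0 <;>
    rcases h.mem_tets_iff.mp (mem_tets h0) with ⟨-, h1, h2⟩ | h1 | h1 | h1
  · exact h1 rfl
  · have : E ∈ ({A, B, C, D} : Finset V) := h1 ▸ by simp
    simp [Ne.symm hAE, Ne.symm hBE, Ne.symm hCE, Ne.symm hDE] at this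
  · have : E ∈ ({A, B, C, D} : Finset V) := h1 ▸ by simp
    simp [Ne.symm hAE, Ne.symm hBE, Ne.symm hCE, Ne.symm hDE] at this
  · have : E ∈ ({A, B, C, D} : Finset V) := h1 ▸ by simp
    simp [Ne.symm hAE, Ne.symm hBE, Ne.symm hCE, Ne.symm hDE] at this
  · exact h2 rfl
  · have : D ∈ ({A, B, C, E} : Finset V) := h1 ▸ by simp
    simp [Ne.symm hAD, Ne.symm hBD, Ne.symm hCD, hDE] at this
  · have : D ∈ ({A, B, C, E} : Finset V) := h1 ▸ by simp
    simp [Ne.symm hAD, Ne.symm hBD, Ne.symm hCD, hDE] at this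
  · have : D ∈ ({A, B, C, E} : Finset V) := h1 ▸ by simp
    simp [Ne.symm hAD, Ne.symm hBD, Ne.symm hCD, hDE] at this

lemma orient_new_eq_zero (h : IsPachnerMove23 K K' A B C D E) (p q : V) :
    K.orient p q D E = 0 := by
  by_contra h0
  exact h.not_mem_tets_of_mem (by simp) (by simp) (mem_tets h0)

lemma subset_of_orient_ne (h : IsPachnerMove23 K K' A B C D E) {p q r s : V}
    (hne : K'.orient p q r s ≠ K.orient p q r s) :
    ({p, q, r, s} : Finset V) ⊆ {A, B, C, D, E} := by
  have hsub : ∀ {t : Finset V}, t = {A, B, C, D} ∨ t = {A, B, C, E} ∨ t = {A, B, D, E} ∨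
      t = {B, C, D, E} ∨ t = {C, A, D, E} → t ⊆ {A, B, C, D, E} := by
    rintro t (rfl | rfl | rfl | rfl | rfl) v hv <;>
    · simp only [Finset.mem_insert, Finset.mem_singleton] at hv ⊢
      tauto
  by_cases hK : ({p, q, r, s} : Finset V) ∈ K.tets
  · by_cases hK' : ({p, q, r, s} : Finset V) ∈ K'.tets
    · exact absurd (h.orient_eq _ _ _ _ hK hK') hne
    · apply hsub
      rw [h.mem_tets_iff] at hK'
      tauto
  · by_cases hK' : ({p, q, r, s} : Finset V) ∈ K'.tets
    · apply hsub
      rw [h.mem_tets_iff] at hK'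
      tauto
    · refine absurd ?_ hne
      rw [not_not.mp (mt mem_tets hK), not_not.mp (mt mem_tets hK')]

/-- Only pairs among the five vertices can be affected. Apart from `DE` each lies in `ABCD` or
`ABCE`, and each lies in one of the three new tetrahedra. -/
lemma edges_eq (h : IsPachnerMove23 K K' A B C D E) : K'.edges = insert s(D, E) K.edges := by
  have m₁ : ∀ v, v ∈ ({A, B, C, D, E} : Finset V) → v ≠ E → v ∈ ({A, B, C, D} : Finset V) := by
    intro v
    simp only [Finset.mem_insert, Finset.mem_singleton]
    tauto
  have m₂ : ∀ v, v ∈ ({A, B, C, D, E} : Finset V) → v ≠ D → v ∈ ({A, B, C, E} : Finset V) := by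
    intro v
    simp only [Finset.mem_insert, Finset.mem_singleton]
    tauto
  have m₃ : ∀ v, v ∈ ({A, B, C, D, E} : Finset V) → v ≠ A → v ∈ ({B, C, D, E} : Finset V) := by
    intro v
    simp only [Finset.mem_insert, Finset.mem_singleton]
    tauto
  have m₅ : ∀ v, v ∈ ({A, B, C, D, E} : Finset V) → v ≠ C → v ∈ ({A, B, D, E} : Finset V) := by
    intro v
    simp only [Finset.mem_insert, Finset.mem_singleton]
    tauto
  have hn := h.nodup
  simp only [List.nodup_cons, List.mem_cons, List.not_mem_nil, or_false, not_or, not_false_eq_true,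
    List.nodup_nil, and_true] at hn
  obtain ⟨⟨hAB, hAC, hAD, hAE⟩, ⟨hBC, hBD, hBE⟩, ⟨hCD, hCE⟩, hDE⟩ := hn
  have n1 : K'.orient A B D E ≠ 0 := by rw [h.orient_new, SignType.neg_ne_zero_iff]; exact h.left
  have n2 : K'.orient B C D E ≠ 0 := by
    rw [h.rotate.orient_new, SignType.neg_ne_zero_iff]; exact h.rotate.left
  have n3 : K'.orient C A D E ≠ 0 := by
    rw [h.rotate.rotate.orient_new, SignType.neg_ne_zero_iff]; exact h.rotate.rotate.left
  ext e
  rw [Finset.mem_insert]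
  constructor
  · intro he
    obtain ⟨p, q, r, s, ho, rfl⟩ := mem_edges_iff.mp he
    have hpq : p ≠ q := by
      have := nodup_of_orient_ne_zero ho
      simp only [List.nodup_cons, List.mem_cons, not_or] at this
      exact this.1.1
    by_cases hK : K.orient p q r s = 0
    swap
    · exact Or.inr (mem_edges₁₂ hK)
    have hs := h.subset_of_orient_ne (show K'.orient p q r s ≠ K.orient p q r s by rwa [hK])
    have hp := hs (show p ∈ _ by simp)
    have hq := hs (show q ∈ _ by simp)
    by_cases hE : p = E ∨ q = E
    · by_cases hD : p = D ∨ q = D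
      · left
        rcases hE with rfl | rfl <;> rcases hD with rfl | rfl
        · exact absurd rfl hDE
        · exact Sym2.eq_swap
        · rfl
        · exact absurd rfl hDE
      · right
        rw [not_or] at hD
        exact mem_edges_of_mem h.right (m₂ p hp hD.1) (m₂ q hq hD.2) hpq
    · right
      rw [not_or] at hE
      exact mem_edges_of_mem h.left (m₁ p hp hE.1) (m₁ q hq hE.2) hpq
  · rintro (rfl | he)
    · exact mem_edges_of_mem n1 (by simp) (by simp) hDE
    obtain ⟨p, q, r, s, ho, rfl⟩ := mem_edges_iff.mp he
    have hpq : p ≠ q := by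
      have := nodup_of_orient_ne_zero ho
      simp only [List.nodup_cons, List.mem_cons, not_or] at this
      exact this.1.1
    by_cases hK : K'.orient p q r s = 0
    swap
    · exact mem_edges₁₂ hK
    have hs := h.subset_of_orient_ne
      (show K'.orient p q r s ≠ K.orient p q r s by rw [hK]; exact ho.symm)
    have hp := hs (show p ∈ _ by simp)
    have hq := hs (show q ∈ _ by simp)
    by_cases hC : p = C ∨ q = C
    · by_cases hA : p = A ∨ q = A
      · rcases hC with rfl | rfl <;> rcases hA with rfl | rfl
        · exact absurd rfl hAC
        · exact mem_edges_of_mem n3 (by simp) (by simp) hpq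
        · exact mem_edges_of_mem n3 (by simp) (by simp) hpq
        · exact absurd rfl hAC
      · rw [not_or] at hA
        exact mem_edges_of_mem n2 (m₃ p hp hA.1) (m₃ q hq hA.2) hpq
    · rw [not_or] at hC
      exact mem_edges_of_mem n1 (m₅ p hp hC.1) (m₅ q hq hC.2) hpq

end OrientedComplex.IsPachnerMove23

/-! ### Genericity, and the geometry of the move. -/

/-- The polynomial in the coordinates of all vertices whose value is `affineDet` of `a, b, c, d`. -/
def affineDetPoly {V : Type*} (a b c d : V) : MvPolynomial (V × Fin 3) ℝ :=
  Matrix.det (Matrix.of fun i : Fin 4 => ![1, .X (![a, b, c, d] i, 0), .X (![a, b, c, d] i, 1),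
    .X (![a, b, c, d] i, 2)])

lemma eval_affineDetPoly {V : Type*} (x : V → E3) (a b c d : V) :
    MvPolynomial.eval (fun i : V × Fin 3 => x i.1 i.2) (affineDetPoly a b c d) =
      affineDet ![x a, x b, x c, x d] := by
  rw [affineDetPoly, RingHom.map_det, affineDet]
  congr 1
  ext i j
  fin_cases i <;> fin_cases j <;> simp

lemma affineDetPoly_ne_zero {V : Type*} [DecidableEq V] {a b c d : V} (h : [a, b, c, d].Nodup) :
    affineDetPoly a b c d ≠ 0 := by
  simp only [List.nodup_cons, List.mem_cons, List.not_mem_nil, or_false, not_or, not_false_eq_true,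
    List.nodup_nil, and_true] at h
  obtain ⟨⟨hab, hac, had⟩, ⟨hbc, hbd⟩, hcd⟩ := h
  intro h0
  -- The standard simplex, with `a` at the origin, has determinant one.
  have h1 := eval_affineDetPoly (fun v => if v = b then !₂[1, 0, 0] else if v = c then !₂[0, 1, 0]
    else if v = d then !₂[0, 0, 1] else 0) a b c d
  rw [h0, map_zero, affineDet_eq] at h1
  simp [hab, hac, had, Ne.symm hbc, Ne.symm hbd, Ne.symm hcd] at h1

namespace OrientedComplex.IsPachnerMove23

open OrientedComplex

variable {V : Type*} [Fintype V] [DecidableEq V] {K K' : OrientedComplex V} {A B C D E : V}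
  {x : V → E3}

lemma permitted_of_affineDet_ne_zero (h : IsPachnerMove23 K K' A B C D E) (hx' : K'.Permitted x)
    (hD : affineDet ![x A, x B, x C, x D] ≠ 0) (hE : affineDet ![x A, x B, x C, x E] ≠ 0) :
    K.Permitted x := by
  intro p q r s ho
  by_cases hK : ({p, q, r, s} : Finset V) ∈ K'.tets
  · refine hx' p q r s ?_
    rwa [h.orient_eq _ _ _ _ (mem_tets ho) hK]
  -- Passing to `tetVolume` makes nondegeneracy a property of the vertex set, so the order in which
  -- the removed tetrahedron is listed is irrelevant.
  rw [← affineDet_ne_zero_iff, ← abs_ne_zero, ← tetVolume_eq x (nodup_of_orient_ne_zero ho)]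
  have hK' : ({p, q, r, s} : Finset V) = {A, B, C, D} ∨
      ({p, q, r, s} : Finset V) = {A, B, C, E} := by
    rw [h.mem_tets_iff] at hK
    have := mem_tets ho
    tauto
  rcases hK' with e | e
  · rw [e, tetVolume_eq x (nodup_of_orient_ne_zero h.left), abs_ne_zero]
    exact hD
  · rw [e, tetVolume_eq x (nodup_of_orient_ne_zero h.right), abs_ne_zero]
    exact hE

lemma orient_new_ne_zero (h : IsPachnerMove23 K K' A B C D E) : K'.orient A B D E ≠ 0 := by
  rw [h.orient_new, SignType.neg_ne_zero_iff]
  exact h.left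

lemma prod_tets (h : IsPachnerMove23 K K' A B C D E) (f : Finset V → ℝ) :
    (∏ t ∈ K'.tets, f t) * (f {A, B, C, D} * f {A, B, C, E}) =
      (∏ t ∈ K.tets, f t) * (f {A, B, D, E} * f {B, C, D, E} * f {C, A, D, E}) := by
  have hn := h.nodup
  simp only [List.nodup_cons, List.mem_cons, List.not_mem_nil, or_false, not_or, not_false_eq_true,
    List.nodup_nil, and_true] at hn
  obtain ⟨⟨hAB, hAC, hAD, hAE⟩, ⟨hBC, hBD, hBE⟩, ⟨hCD, hCE⟩, hDE⟩ := hn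
  have hsub : {{A, B, C, D}, {A, B, C, E}} ⊆ K.tets := by
    intro t ht
    rw [Finset.mem_insert, Finset.mem_singleton] at ht
    rcases ht with rfl | rfl
    · exact mem_tets h.left
    · exact mem_tets h.right
  have hdisj : Disjoint (K.tets \ {{A, B, C, D}, {A, B, C, E}})
      {{A, B, D, E}, {B, C, D, E}, {C, A, D, E}} := by
    refine Finset.disjoint_right.mpr fun t ht ht' => ?_
    refine h.not_mem_tets_of_mem (t := t) ?_ ?_ (Finset.mem_sdiff.mp ht').1 <;>
    · simp only [Finset.mem_insert, Finset.mem_singleton] at ht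
      rcases ht with rfl | rfl | rfl <;> simp
  have h1 : ({A, B, C, D} : Finset V) ∉ ({{A, B, C, E}} : Finset (Finset V)) := by
    rw [Finset.mem_singleton]
    intro e
    have : D ∈ ({A, B, C, E} : Finset V) := e ▸ by simp
    simp [Ne.symm hAD, Ne.symm hBD, Ne.symm hCD, hDE] at this
  have h2 : ({A, B, D, E} : Finset V) ∉ ({{B, C, D, E}, {C, A, D, E}} : Finset (Finset V)) := by
    rw [Finset.mem_insert, Finset.mem_singleton]
    rintro (e | e)
    · have : A ∈ ({B, C, D, E} : Finset V) := e ▸ by simp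
      simp [hAB, hAC, hAD, hAE] at this
    · have : B ∈ ({C, A, D, E} : Finset V) := e ▸ by simp
      simp [hBC, Ne.symm hAB, hBD, hBE] at this
  have h3 : ({B, C, D, E} : Finset V) ∉ ({{C, A, D, E}} : Finset (Finset V)) := by
    rw [Finset.mem_singleton]
    intro e
    have : B ∈ ({C, A, D, E} : Finset V) := e ▸ by simp
    simp [hBC, Ne.symm hAB, hBD, hBE] at this
  have hK := Finset.prod_sdiff (f := f) hsub
  have hK' : (∏ t ∈ K'.tets, f t) = (∏ t ∈ K.tets \ {{A, B, C, D}, {A, B, C, E}}, f t) *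
      ∏ t ∈ {{A, B, D, E}, {B, C, D, E}, {C, A, D, E}}, f t := by
    rw [← Finset.prod_union hdisj, h.tets_eq]
  rw [Finset.prod_insert h1, Finset.prod_singleton] at hK
  rw [Finset.prod_insert h2, Finset.prod_insert h3, Finset.prod_singleton] at hK'
  rw [hK', ← hK]
  ring

lemma affineDet_ne_zero (h : IsPachnerMove23 K K' A B C D E) (hx : K.Permitted x)
    (hx' : K'.Permitted x) :
    affineDet ![x A, x B, x C, x D] ≠ 0 ∧ affineDet ![x A, x B, x C, x E] ≠ 0 ∧
      affineDet ![x A, x B, x D, x E] ≠ 0 ∧ affineDet ![x B, x C, x D, x E] ≠ 0 ∧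
      affineDet ![x C, x A, x D, x E] ≠ 0 := by
  simp only [affineDet_ne_zero_iff]
  exact ⟨hx _ _ _ _ h.left, hx _ _ _ _ h.right, hx' _ _ _ _ h.orient_new_ne_zero,
    hx' _ _ _ _ h.rotate.orient_new_ne_zero, hx' _ _ _ _ h.rotate.rotate.orient_new_ne_zero⟩

/-- Closedness of both complexes fixes the signs of the five tetrahedra relative to `ABCD`, and
these are the boundary signs of a 4-simplex. -/
lemma exists_isSimplexBoundary (h : IsPachnerMove23 K K' A B C D E) (hx : K.Permitted x)
    (hx' : K'.Permitted x) : ∃ μ M η, IsSimplexBoundary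
      (fun a b c d => (K'.orient a b c d : ℝ) - K.orient a b c d) x μ M η A B C D E := by
  have hn := h.nodup
  have hnd := h.nodup
  simp only [List.nodup_cons, List.mem_cons, List.not_mem_nil, or_false, not_or, not_false_eq_true,
    List.nodup_nil, and_true] at hn
  obtain ⟨⟨hAB, hAC, hAD, hAE⟩, ⟨hBC, hBD, hBE⟩, ⟨hCD, hCE⟩, hDE⟩ := hn
  obtain ⟨d5, d4, d3, d1, d2⟩ := h.affineDet_ne_zero hx hx'
  rw [affineDet_swap₁₂, neg_ne_zero] at d2
  -- Forced by `value₅`: `ABCD` occurs only in `K`, so its difference of signs is `-K.orient A B C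
  -- D`.
  obtain ⟨η, hη⟩ : ∃ η : ℝ, η = -(K.orient A B C D : ℝ) := ⟨_, rfl⟩
  have hsq : η ^ 2 = 1 := by
    have := h.left
    rw [hη]
    rcases hs : K.orient A B C D with _ | _ | _ <;> simp_all
  have hη0 : η ≠ 0 := by
    rintro rfl
    norm_num at hsq
  have w1 : (K'.orient A B D E : ℝ) = -K.orient A B C D := by
    rw [h.orient_new, SignType.coe_neg]
  have hrot : K.orient B C A D = K.orient A B C D := by
    rw [K.swap₂₃, K.swap₁₂, neg_neg]
  have hrot' : K.orient C A B D = K.orient A B C D := by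
    rw [K.swap₁₂, K.swap₂₃, neg_neg]
  have w2 : (K'.orient B C D E : ℝ) = -K.orient A B C D := by
    rw [h.rotate.orient_new, SignType.coe_neg, hrot]
  have w3 : (K'.orient A C D E : ℝ) = K.orient A B C D := by
    rw [K'.swap₁₂, h.rotate.rotate.orient_new, neg_neg, hrot']
  have w4 : (K.orient A B C E : ℝ) = -K.orient A B C D := by
    rw [h.orient_right, SignType.coe_neg]
  let μ : V → ℝ := fun v =>
    if v = A then η * affineDet ![x B, x C, x D, x E]
    else if v = B then -η * affineDet ![x A, x C, x D, x E]
    else if v = C then η * affineDet ![x A, x B, x D, x E]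
    else if v = D then -η * affineDet ![x A, x B, x C, x E]
    else if v = E then η * affineDet ![x A, x B, x C, x D] else 0
  have m1 : μ A = η * affineDet ![x B, x C, x D, x E] := if_pos rfl
  have m2 : μ B = -η * affineDet ![x A, x C, x D, x E] := by simp [μ, Ne.symm hAB]
  have m3 : μ C = η * affineDet ![x A, x B, x D, x E] := by simp [μ, Ne.symm hAC, Ne.symm hBC]
  have m4 : μ D = -η * affineDet ![x A, x B, x C, x E] := by
    simp [μ, Ne.symm hAD, Ne.symm hBD, Ne.symm hCD]
  have m5 : μ E = η * affineDet ![x A, x B, x C, x D] := by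
    simp [μ, Ne.symm hAE, Ne.symm hBE, Ne.symm hCE, Ne.symm hDE]
  refine ⟨μ, _, η, hsq, hnd, ?_, ?_, ?_, ?_, ?_, ?_, ?_, ?_, ?_, m1, m2, m3, m4, m5, ?_, rfl, ?_⟩
  · intro a b c d
    rw [K.swap₁₂, K'.swap₁₂, SignType.coe_neg, SignType.coe_neg]
    ring
  · intro a b c d
    rw [K.swap₂₃, K'.swap₂₃, SignType.coe_neg, SignType.coe_neg]
    ring
  · intro a b c d
    rw [K.swap₃₄, K'.swap₃₄, SignType.coe_neg, SignType.coe_neg]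
    ring
  · intro a b c d hne v hv
    have hs := h.subset_of_orient_ne (p := a) (q := b) (r := c) (s := d)
      fun e => hne (by rw [e, sub_self])
    simpa using hs (show v ∈ _ by simpa using hv)
  · rw [w2, h.orient_new_eq_zero, hη, SignType.coe_zero, sub_zero]
  · rw [w3, h.orient_new_eq_zero, hη, SignType.coe_zero, sub_zero, neg_neg]
  · rw [w1, h.orient_new_eq_zero, hη, SignType.coe_zero, sub_zero]
  · rw [h.orient_old.2, w4, hη, SignType.coe_zero, zero_sub]
  · rw [h.orient_old.1, hη, SignType.coe_zero, zero_sub]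
  · intro v hv
    simp only [List.mem_cons, List.not_mem_nil, or_false, not_or] at hv
    simp [μ, hv]
  · rw [m1, m2, m3, m4, m5]
    have hη1 := neg_ne_zero.mpr hη0
    exact mul_ne_zero (mul_ne_zero (mul_ne_zero (mul_ne_zero (mul_ne_zero hη0 d1)
      (mul_ne_zero hη1 d2)) (mul_ne_zero hη0 d3)) (mul_ne_zero hη1 d4)) (mul_ne_zero hη0 d5)

/-- The matrix of the new complex is a rank one perturbation of the old one. -/
lemma exists_curvDeriv_eq (h : IsPachnerMove23 K K' A B C D E) (hx : K.Permitted x)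
    (hx' : K'.Permitted x) : ∃ (w : Sym2 V → ℝ) (c : ℝ),
      (∀ a b, K'.curvDeriv x a b = K.curvDeriv x a b - c * w a * w b) ∧ w s(D, E) ≠ 0 ∧ c ≠ 0 ∧
      edgeLength x s(D, E) ≠ 0 ∧
      |c * w s(D, E) ^ 2| * (6 * tetVolume x {A, B, D, E} * (6 * tetVolume x {B, C, D, E}) *
        (6 * tetVolume x {C, A, D, E})) = edgeLength x s(D, E) ^ 2 *
        (6 * tetVolume x {A, B, C, D} * (6 * tetVolume x {A, B, C, E})) := by
  obtain ⟨μ, M, η, hμ⟩ := h.exists_isSimplexBoundary hx hx'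
  obtain ⟨d5, d4, d3, d1, d2⟩ := h.affineDet_ne_zero hx hx'
  have hM := hμ.ne_zero
  have hM' := hμ.ne_zero
  rw [← hμ.prod] at hM'
  simp only [mul_ne_zero_iff] at hM'
  obtain ⟨⟨⟨⟨h1, h2⟩, h3⟩, h4⟩, h5⟩ := hM'
  have hl : edgeLength x s(D, E) ≠ 0 := by
    have hDE : x D ≠ x E := by
      intro e
      apply d3
      rw [e, affineDet_eq]
      ring
    simpa [edgeLength] using hDE
  have habs : |η| = 1 := by
    rw [← sq_eq_sq₀ (abs_nonneg _) zero_le_one, sq_abs, hμ.sq, one_pow]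
  refine ⟨edgeWeight x μ, M⁻¹, curvDeriv_eq_add hx hx' hμ, ?_, inv_ne_zero hM, hl, ?_⟩
  · rw [edgeWeight_mk]
    exact mul_ne_zero hl (mul_ne_zero h4 h5)
  rw [tetVolume_eq x (nodup_of_orient_ne_zero h.left),
    tetVolume_eq x (nodup_of_orient_ne_zero h.right),
    tetVolume_eq x (nodup_of_orient_ne_zero h.orient_new_ne_zero),
    tetVolume_eq x (nodup_of_orient_ne_zero h.rotate.orient_new_ne_zero),
    tetVolume_eq x (nodup_of_orient_ne_zero h.rotate.rotate.orient_new_ne_zero)]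
  have a1 : |affineDet ![x B, x C, x D, x E]| = |μ A| := by rw [hμ.weight₁, abs_mul, habs, one_mul]
  have a2 : |affineDet ![x C, x A, x D, x E]| = |μ B| := by
    rw [hμ.weight₂, abs_mul, abs_neg, habs, one_mul, affineDet_swap₁₂, abs_neg]
  have a3 : |affineDet ![x A, x B, x D, x E]| = |μ C| := by rw [hμ.weight₃, abs_mul, habs, one_mul]
  have a4 : |affineDet ![x A, x B, x C, x E]| = |μ D| := by
    rw [hμ.weight₄, abs_mul, abs_neg, habs, one_mul]
  have a5 : |affineDet ![x A, x B, x C, x D]| = |μ E| := by rw [hμ.weight₅, abs_mul, habs, one_mul]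
  -- In terms of `μ` the claim is `|w_DE² / M| = l_DE² * |μ D * μ E| / |μ A * μ B * μ C|`.
  rw [a1, a2, a3, a4, a5, edgeWeight_mk, ← hμ.prod]
  simp only [abs_mul, abs_inv, abs_pow]
  rw [← sq_abs (edgeLength x s(D, E))]
  have := abs_ne_zero.mpr h1
  have := abs_ne_zero.mpr h2
  have := abs_ne_zero.mpr h3
  have := abs_ne_zero.mpr h4
  have := abs_ne_zero.mpr h5
  field_simp

end OrientedComplex.IsPachnerMove23

end

theorem theorem3 {V : Type*} [Fintype V] [DecidableEq V] (K K' : OrientedComplex V)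
    (A B C D E : V) (hmove : OrientedComplex.IsPachnerMove23 K K' A B C D E)
    (S : Finset (Sym2 V)) (hS : K.IsMaximalSet S) :
    K'.IsMaximalSet (insert s(D, E) S) ∧
      ∀ x : V → E3, K.Permitted x → K'.Permitted x →
        (K'.invariantExpr x (insert s(D, E) S) = K.invariantExpr x S ∨
          K'.invariantExpr x (insert s(D, E) S) = -K.invariantExpr x S) := by
  obtain ⟨hSE, P, hP, hgen⟩ := hS
  have hd : s(D, E) ∉ S := fun hmem => hmove.newEdge (hSE hmem)
  have hSE' : insert s(D, E) S ⊆ K'.edges := by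
    rw [hmove.edges_eq]
    exact Finset.insert_subset_insert _ hSE
  -- A placement permitted for `K'` may flatten `ABCD` or `ABCE`; the two extra factors exclude
  -- this, so that the genericity of `K` applies.
  refine ⟨⟨hSE', P * affineDetPoly A B C D * affineDetPoly A B C E, ?_, ?_⟩, ?_⟩
  · exact mul_ne_zero (mul_ne_zero hP
      (affineDetPoly_ne_zero (OrientedComplex.nodup_of_orient_ne_zero hmove.left)))
      (affineDetPoly_ne_zero (OrientedComplex.nodup_of_orient_ne_zero hmove.right))
  · intro x hx' hne
    rw [map_mul, map_mul, eval_affineDetPoly, eval_affineDetPoly, mul_ne_zero_iff,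
      mul_ne_zero_iff] at hne
    have hx := hmove.permitted_of_affineDet_ne_zero hx' hne.1.2 hne.2
    obtain ⟨hm, hr⟩ := hgen x hx hne.1.1
    obtain ⟨w, c, hw, hwd, hc, -⟩ := hmove.exists_curvDeriv_eq hx hx'
    have hdet := det_insert_of_sub_mul S hd _ _ w c hw
      (OrientedComplex.curvDeriv_eq_zero_of_left hx hmove.newEdge)
      (fun i => OrientedComplex.curvDeriv_eq_zero_of_right hx i hmove.newEdge) hwd
    have hm' : K'.minor x (insert s(D, E) S) ≠ 0 := by
      rw [OrientedComplex.minor, hdet]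
      exact mul_ne_zero (mul_ne_zero (neg_ne_zero.mpr hc) (pow_ne_zero 2 hwd)) hm
    -- The nonzero minor bounds the rank below; the rank one perturbation bounds it above by the old
    -- rank plus one.
    refine ⟨hm', le_antisymm ?_ (card_le_rank_of_det_ne_zero _ _ hSE' _ hm')⟩
    rw [Finset.card_insert_of_notMem hd, ← hr]
    exact rank_sub_mul_le K.edges K'.edges _ _ w c hw
      (fun i j hi => OrientedComplex.curvDeriv_eq_zero_of_left hx hi j)
      (fun i j hj => OrientedComplex.curvDeriv_eq_zero_of_right hx i hj)
  · intro x hx hx'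
    obtain ⟨w, c, hw, hwd, -, hl, hV⟩ := hmove.exists_curvDeriv_eq hx hx'
    have hdet : K'.minor x (insert s(D, E) S) = -c * w s(D, E) ^ 2 * K.minor x S :=
      det_insert_of_sub_mul S hd _ _ w c hw
        (OrientedComplex.curvDeriv_eq_zero_of_left hx hmove.newEdge)
        (fun i => OrientedComplex.curvDeriv_eq_zero_of_right hx i hmove.newEdge) hwd
    have hprod := hmove.prod_tets fun t => 6 * tetVolume x t
    have hv : 6 * tetVolume x {A, B, C, D} * (6 * tetVolume x {A, B, C, E}) ≠ 0 := by
      obtain ⟨d1, d2, -⟩ := hmove.affineDet_ne_zero hx hx'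
      rw [tetVolume_eq x (OrientedComplex.nodup_of_orient_ne_zero hmove.left),
        tetVolume_eq x (OrientedComplex.nodup_of_orient_ne_zero hmove.right)]
      exact mul_ne_zero (abs_ne_zero.mpr d1) (abs_ne_zero.mpr d2)
    have key : |c * w s(D, E) ^ 2| * (∏ t ∈ K'.tets, 6 * tetVolume x t) =
        edgeLength x s(D, E) ^ 2 * ∏ t ∈ K.tets, 6 * tetVolume x t := by
      refine mul_right_cancel₀ hv ?_
      linear_combination |c * w s(D, E) ^ 2| * hprod + (∏ t ∈ K.tets, 6 * tetVolume x t) * hV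
    have hinv : K.invariantExpr x S = |c * w s(D, E) ^ 2| * K.minor x S *
        (∏ t ∈ K'.tets, 6 * tetVolume x t) / ∏ e ∈ K'.edges, edgeLength x e ^ 2 := by
      rw [mul_right_comm, key, hmove.edges_eq, Finset.prod_insert hmove.newEdge,
        OrientedComplex.invariantExpr, mul_assoc, mul_div_mul_left _ _ (pow_ne_zero 2 hl),
        mul_comm (K.minor x S)]
    rw [hinv, OrientedComplex.invariantExpr, hdet]
    -- Only the sign of `c * w s(D, E) ^ 2` remains undetermined, whence the ambiguity of sign.
    rcases abs_choice (c * w s(D, E) ^ 2) with e | e <;> rw [e]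
    · right
      ring
    · left
      ring
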